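/- For $g\in L^2(\mathbb{R})$ let $\hat g$ be its Fourier transform, normalized by $\hat g(\xi)=\int_{\mathbb{R}} g(t)e^{-2\pi i\xi t}\,dt$ for integrable $g$, and let $G(g)=\{e^{2\pi i nt}g(t-m)\}_{(m,n)\in\mathbb{Z}^2}$ be the Gabor system generated by $g$. We say that $G(g)=\{f_{m,n}\}$ is a Riesz basis with bounds $A,B>0$ if it is complete in $L^2(\mathbb{R})$ (its linear span is dense) and, for every $a\in\ell^2(\mathbb{Z}^2)$, the series $\sum a_{m,n}f_{m,n}$ converges in $L^2(\mathbb{R})$ and $$A\sum|a_{m,n}|^2\le\Big\|\sum a_{m,n}f_{m,n}\Big\|^2\le B\sum|a_{m,n}|^2 .$$ **Theorem.** For all $A,B>0$ there is a constant $C>0$, depending only on $A$ and $B$, such that for every $g\in L^2(\mathbb{R})$ for which $G(g)$ is a Riesz basis with bounds $A,B$, and all $R,L\ge 1$, $$\int_{|t|\ge R}|g(t)|^2\,dt+\int_{|\xi|\ge L}|\hat g(\xi)|^2\,d\xi\ \ge\ \frac{C}{RL}.$$ The result is sharp in the sense that, for large enough $C$, the lower bound cannot be replaced by $C\log(RL)/(RL)$,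 not even for large $R=L$: there are a function $g\in L^2(\mathbb{R})$ for which $G(g)$ is an orthonormal basis of $L^2(\mathbb{R})$ and a constant $C_0>0$ such that, for every $C\ge C_0$ and all $R=L\ge 2$, $$\int_{|t|\ge R}|g(t)|^2\,dt+\int_{|\xi|\ge L}|\hat g(\xi)|^2\,d\xi\ <\ \frac{C\log(RL)}{RL}.$$ -/

import Mathlib

open MeasureTheory
open scoped FourierTransform

/-- The Hilbert space `L²(ℝ)` of complex-valued functions, with Lebesgue measure. -/
abbrev L2R : Type := Lp ℂ 2 (volume : Measure ℝ)

/-- The time-frequency shift `t ↦ e^{2πint} g(t - m)`. -/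
noncomputable def timeFreqShift (g : ℝ → ℂ) (m n : ℤ) : ℝ → ℂ := fun t =>
  Complex.exp (2 * (Real.pi : ℂ) * Complex.I * (n : ℂ) * (t : ℂ)) * g (t - (m : ℝ))

theorem memLp_timeFreqShift {g : ℝ → ℂ} (hg : MemLp g 2 (volume : Measure ℝ)) (m n : ℤ) :
    MemLp (timeFreqShift g m n) 2 (volume : Measure ℝ) := by
  have h1 : MemLp (fun t : ℝ => g (t - (m : ℝ))) 2 (volume : Measure ℝ) :=
    hg.comp_measurePreserving (measurePreserving_sub_right volume (m : ℝ))
  have hc : Continuous (fun t : ℝ =>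
      Complex.exp (2 * (Real.pi : ℂ) * Complex.I * (n : ℂ) * (t : ℂ))) := by fun_prop
  refine h1.of_le (hc.aestronglyMeasurable.mul h1.1) (Filter.Eventually.of_forall fun t => ?_)
  have e : 2 * (Real.pi : ℂ) * Complex.I * (n : ℂ) * (t : ℂ)
      = ((2 * Real.pi * (n : ℝ) * t : ℝ) : ℂ) * Complex.I := by
    push_cast
    ring
  simp only [timeFreqShift]
  rw [norm_mul, e, Complex.norm_exp_ofReal_mul_I, one_mul]

/-- The Gabor system `G(g) = {e^{2πint} g(t - m)}`, indexed by `(m, n) ∈ ℤ²`, in `L²(ℝ)`. -/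
noncomputable def gaborSystem (g : L2R) (p : ℤ × ℤ) : L2R :=
  (memLp_timeFreqShift (Lp.memLp g) p.1 p.2).toLp (timeFreqShift g p.1 p.2)

/-- The family `f` is complete in `H`: its linear span is dense. -/
def IsCompleteSystem {ι H : Type*} [NormedAddCommGroup H] [InnerProductSpace ℂ H]
    (f : ι → H) : Prop :=
  (Submodule.span ℂ (Set.range f)).topologicalClosure = ⊤

/-- `f` is a Riesz basis of `H` for which `A` and `B` are admissible (not necessarily optimal)
positive bounds: `f` is complete and, for every `a ∈ ℓ²`, the series `∑ aᵢ fᵢ` converges and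
`A ∑ |aᵢ|² ≤ ‖∑ aᵢ fᵢ‖² ≤ B ∑ |aᵢ|²`. -/
def IsRieszBasisWithBounds {ι H : Type*} [NormedAddCommGroup H] [InnerProductSpace ℂ H]
    (f : ι → H) (A B : ℝ) : Prop :=
  0 < A ∧ 0 < B ∧ IsCompleteSystem f ∧
    ∀ a : ι → ℂ, Summable (fun i => ‖a i‖ ^ 2) →
      ∃ s : H, HasSum (fun i => a i • f i) s ∧
        A * ∑' i, ‖a i‖ ^ 2 ≤ ‖s‖ ^ 2 ∧ ‖s‖ ^ 2 ≤ B * ∑' i, ‖a i‖ ^ 2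

/-- `f` is an orthonormal basis of `H`: orthonormal and complete. -/
def IsOrthonormalBasis {ι H : Type*} [NormedAddCommGroup H] [InnerProductSpace ℂ H]
    (f : ι → H) : Prop :=
  Orthonormal ℂ f ∧ IsCompleteSystem f

/-- `∫_{|t| ≥ R} |g(t)|² dt + ∫_{|ξ| ≥ L} |ĝ(ξ)|² dξ`, where `ĝ = 𝓕 g` is the Fourier
transform on `L²(ℝ)`, normalized by `ĝ(ξ) = ∫ g(t) e^{-2πiξt} dt` for integrable `g`. -/
noncomputable def timeFreqTail (g : L2R) (R L : ℝ) : ℝ :=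
  (∫ t in {t : ℝ | R ≤ |t|}, ‖g t‖ ^ 2) + ∫ ξ in {ξ : ℝ | L ≤ |ξ|}, ‖(𝓕 g : L2R) ξ‖ ^ 2

/-!
The inverse Zak transform is a unitary map `L²([0,1)²) → L²(ℝ)` under which the Gabor system of `g`
becomes the Fourier characters times the Zak transform `F` of `g`. A Riesz sequence with bounds
`A, B` forces `A ≤ |F|² ≤ B` almost everywhere, and `|F| = 1` gives an orthonormal basis.

Lower bound: `F` is quasi-periodic, so along a grid of the square the winding number of `F` in the
second variable changes by one when the first variable increases by one. Hence `F` cannot vary by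
less than its modulus along every edge of the grid; averaging over translates of a grid of about
`R × L` cells, increments of fixed size occur on a set of measure at least `1 / (RL)`. Combinations
of increments whose symbol vanishes on low frequencies bound this variation by the tails of `g`
and `ĝ`.

Upper bound: the Zak transform of the hat function has a single zero in the square and modulus
comparable to the distance to it, so its phase is unimodular with increments of order `s / dist`.
Integrating the square of this over the square costs only a logarithm.
-/

open Set Filter Topology
open scoped ENNReal

/-! ### The unit interval and the unit square -/

/-- The character `t ↦ e^{2πit}` of `ℝ`, with values in `ℂ` so that it can multiply functions. -/
noncomputable def expi (t : ℝ) : ℂ := 𝐞 t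

theorem expi_eq (t : ℝ) : expi t = Complex.exp (((2 * Real.pi * t : ℝ) : ℂ) * Complex.I) :=
  Real.fourierChar_apply t

theorem expi_eq' (t : ℝ) : expi t = Complex.exp (2 * Real.pi * Complex.I * t) := by
  rw [expi_eq]; congr 1; push_cast; ring

@[simp] theorem norm_expi (t : ℝ) : ‖expi t‖ = 1 := Circle.norm_coe _

@[simp] theorem enorm_expi (t : ℝ) : ‖expi t‖ₑ = 1 := by
  rw [← ofReal_norm, norm_expi, ENNReal.ofReal_one]

theorem expi_ne_zero (t : ℝ) : expi t ≠ 0 := Circle.coe_ne_zero _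

@[simp] theorem expi_zero : expi 0 = 1 := by simp [expi]

theorem expi_add (s t : ℝ) : expi (s + t) = expi s * expi t := by
  simp only [expi, AddChar.map_add_eq_mul, Circle.coe_mul]

@[simp] theorem expi_intCast (n : ℤ) : expi n = 1 := by
  rw [expi_eq', Complex.exp_eq_one_iff]
  exact ⟨n, by push_cast; ring⟩

theorem expi_add_intCast (t : ℝ) (n : ℤ) : expi (t + n) = expi t := by
  rw [expi_add, expi_intCast, mul_one]

@[fun_prop] theorem continuous_expi : Continuous expi := by
  unfold expi; fun_prop

@[fun_prop] theorem measurable_expi : Measurable expi := continuous_expi.measurable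

theorem fourier_coe_eq_expi (n : ℤ) (x : ℝ) :
    fourier n (x : AddCircle (1 : ℝ)) = expi (n * x) := by
  rw [fourier_coe_apply, expi_eq']; congr 1; push_cast; ring

/-- Lebesgue measure on `[0, 1)`, a fundamental domain of `ℝ / ℤ`. -/
noncomputable def unitMeasure : Measure ℝ := volume.restrict (Ico 0 1)

theorem unitMeasure_eq_Ioc : unitMeasure = volume.restrict (Ioc 0 1) :=
  restrict_Ico_eq_restrict_Ioc

instance : IsProbabilityMeasure unitMeasure := ⟨by simp [unitMeasure]⟩

/-- Lebesgue measure on `[0, 1)²`, the domain of the Zak transform. -/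
noncomputable def squareMeasure : Measure (ℝ × ℝ) := unitMeasure.prod unitMeasure

instance : IsProbabilityMeasure squareMeasure := by unfold squareMeasure; infer_instance

theorem squareMeasure_eq_restrict : squareMeasure = volume.restrict (Ico 0 1 ×ˢ Ico 0 1) := by
  rw [squareMeasure, unitMeasure, Measure.prod_restrict]; rfl

theorem ae_unitMeasure_mem : ∀ᵐ x ∂unitMeasure, x ∈ Ico (0 : ℝ) 1 :=
  ae_restrict_mem measurableSet_Ico

theorem integral_unitMeasure (f : ℝ → ℂ) : ∫ y, f y ∂unitMeasure = ∫ y in (0 : ℝ)..1, f y := by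
  rw [intervalIntegral.integral_of_le zero_le_one, unitMeasure_eq_Ioc]

theorem lintegral_squareMeasure {f : ℝ × ℝ → ℝ≥0∞} (hf : AEMeasurable f squareMeasure) :
    ∫⁻ p, f p ∂squareMeasure = ∫⁻ x, ∫⁻ y, f (x, y) ∂unitMeasure ∂unitMeasure :=
  lintegral_prod _ hf

section SquareIntegrable

variable {α E : Type*} [MeasurableSpace α] [NormedAddCommGroup E] {μ : Measure α} {f : α → E}

theorem lintegral_enorm_sq_eq_ofReal (hf : MemLp f 2 μ) :
    ∫⁻ x, ‖f x‖ₑ ^ 2 ∂μ = ENNReal.ofReal (∫ x, ‖f x‖ ^ 2 ∂μ) := by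
  have hi : Integrable (fun x => ‖f x‖ ^ 2) μ := by simpa using hf.integrable_norm_pow two_ne_zero
  rw [ofReal_integral_eq_lintegral_ofReal hi (Eventually.of_forall fun x => by positivity)]
  refine lintegral_congr fun x => ?_
  rw [ENNReal.ofReal_pow (norm_nonneg _), ofReal_norm]

theorem memLp_two_iff_lintegral (hf : AEStronglyMeasurable f μ) :
    MemLp f 2 μ ↔ ∫⁻ x, ‖f x‖ₑ ^ 2 ∂μ < ⊤ := by
  rw [MemLp, and_iff_right hf, eLpNorm_lt_top_iff_lintegral_rpow_enorm_lt_top (by simp) (by simp)]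
  simp

theorem enorm_toLp_sq (hf : MemLp f 2 μ) : ‖hf.toLp f‖ₑ ^ 2 = ∫⁻ x, ‖f x‖ₑ ^ 2 ∂μ := by
  rw [Lp.enorm_toLp, eLpNorm_eq_lintegral_rpow_enorm_toReal (by simp) (by simp),
    ← ENNReal.rpow_natCast, ← ENNReal.rpow_mul]
  simp

theorem enorm_Lp_sq (f : Lp E 2 μ) : ‖f‖ₑ ^ 2 = ∫⁻ x, ‖f x‖ₑ ^ 2 ∂μ := by
  rw [← enorm_toLp_sq (Lp.memLp f), Lp.toLp_coeFn]

end SquareIntegrable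

theorem fourierCoeffOn_eq_integral_expi (f : ℝ → ℂ) (k : ℤ) :
    fourierCoeffOn zero_lt_one f k = ∫ y, expi (-k * y) * f y ∂unitMeasure := by
  rw [fourierCoeffOn_eq_integral, integral_unitMeasure, sub_zero, div_one, one_smul]
  refine intervalIntegral.integral_congr fun y _ => ?_
  rw [smul_eq_mul, fourier_coe_apply, expi_eq']
  congr 2
  push_cast
  ring

theorem tsum_enorm_integral_expi_sq {f : ℝ → ℂ} (hf : MemLp f 2 unitMeasure) :
    ∑' k : ℤ, ‖∫ y, expi (k * y) * f y ∂unitMeasure‖ₑ ^ 2 = ∫⁻ y, ‖f y‖ₑ ^ 2 ∂unitMeasure := by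
  have parseval := hasSum_sq_fourierCoeffOn zero_lt_one (unitMeasure_eq_Ioc ▸ hf)
  rw [sub_zero, inv_one, one_smul, intervalIntegral.integral_of_le zero_le_one,
    ← unitMeasure_eq_Ioc] at parseval
  rw [lintegral_enorm_sq_eq_ofReal hf, ← parseval.tsum_eq,
    ENNReal.ofReal_tsum_of_nonneg (fun _ => by positivity) parseval.summable,
    ← (Equiv.neg ℤ).tsum_eq]
  refine tsum_congr fun k => ?_
  rw [ENNReal.ofReal_pow (norm_nonneg _), ofReal_norm, fourierCoeffOn_eq_integral_expi,
    Equiv.neg_apply, Int.cast_neg]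

theorem integral_expi_intCast_mul (k : ℤ) :
    ∫ y, expi (k * y) ∂unitMeasure = if k = 0 then 1 else 0 := by
  have h := congrFun (fourierCoeff_fourier (T := 1) k) 0
  rw [fourierCoeff_eq_intervalIntegral _ _ 0] at h
  simp only [zero_add, neg_zero, div_one, one_smul, fourier_zero, Pi.single_apply] at h
  simp only [integral_unitMeasure, ← fourier_coe_eq_expi]
  simpa only [eq_comm] using h

theorem lintegral_eq_tsum_unitMeasure (f : ℝ → ℝ≥0∞) :
    ∫⁻ t, f t = ∑' k : ℤ, ∫⁻ x, f (x + k) ∂unitMeasure := by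
  rw [← setLIntegral_univ, ← iUnion_Ico_intCast ℝ,
    lintegral_iUnion (fun _ => measurableSet_Ico) (pairwise_disjoint_Ico_intCast ℝ)]
  refine tsum_congr fun k => ?_
  have hk := measurePreserving_add_right (volume : Measure ℝ) (k : ℝ)
  have h := hk.setLIntegral_comp_preimage_emb (measurableEmbedding_addRight _) f
    (Ico (k : ℝ) (k + 1))
  have hpre : (· + (k : ℝ)) ⁻¹' Ico (k : ℝ) (k + 1) = Ico 0 1 := by ext x; simp
  rw [← h, hpre, unitMeasure]

theorem floor_add_of_mem_Ico {x : ℝ} (hx : x ∈ Ico (0 : ℝ) 1) (k : ℤ) : ⌊x + k⌋ = k := by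
  rw [Int.floor_add_intCast, Int.floor_eq_zero_iff.2 hx, zero_add]

theorem fract_add_of_mem_Ico {x : ℝ} (hx : x ∈ Ico (0 : ℝ) 1) (k : ℤ) :
    Int.fract (x + k) = x := by
  rw [Int.fract_add_intCast, Int.fract_eq_self.2 hx]

theorem quasiMeasurePreserving_fract :
    Measure.QuasiMeasurePreserving (Int.fract : ℝ → ℝ) volume unitMeasure := by
  refine ⟨measurable_fract, Measure.AbsolutelyContinuous.mk fun s hs h0 => ?_⟩
  rw [Measure.map_apply measurable_fract hs, ← lintegral_indicator_one (measurable_fract hs),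
    lintegral_eq_tsum_unitMeasure]
  refine ENNReal.tsum_eq_zero.2 fun k => ?_
  rw [← h0, ← lintegral_indicator_one hs]
  refine lintegral_congr_ae ?_
  filter_upwards [ae_unitMeasure_mem] with x hx
  by_cases hxs : x ∈ s <;> simp [hxs, Int.fract_eq_self.2 hx]

/-! ### The inverse Zak transform -/

/-- The inverse Zak transform of a function on `[0, 1)²`: the Zak transform sends `g` to
`(x, y) ↦ ∑ₖ g(x + k) e^{-2πiky}`, so `g(x + k)` is a Fourier coefficient of its slice at `x`. -/
noncomputable def zakInv (F : ℝ × ℝ → ℂ) (t : ℝ) : ℂ :=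
  ∫ y, expi (⌊t⌋ * y) * F (Int.fract t, y) ∂unitMeasure

theorem zakInv_congr_ae {F G : ℝ × ℝ → ℂ} (h : F =ᵐ[squareMeasure] G) :
    zakInv F =ᵐ[volume] zakInv G := by
  have h1 : ∀ᵐ x ∂unitMeasure, ∀ᵐ y ∂unitMeasure, F (x, y) = G (x, y) :=
    Measure.ae_ae_of_ae_prod h
  filter_upwards [quasiMeasurePreserving_fract.ae h1] with t ht
  refine integral_congr_ae ?_
  filter_upwards [ht] with y hy
  rw [hy]

theorem zakInv_smul (c : ℂ) (F : ℝ × ℝ → ℂ) : zakInv (c • F) = c • zakInv F := by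
  funext t
  simp only [zakInv, Pi.smul_apply, smul_eq_mul, mul_left_comm _ c, integral_const_mul]

section SquareIntegrable

variable {F : ℝ × ℝ → ℂ}

theorem stronglyMeasurable_zakInv (hF : StronglyMeasurable F) :
    StronglyMeasurable (zakInv F) := by
  have hfloor : Measurable fun p : ℝ × ℝ => ((⌊p.1⌋ : ℤ) : ℝ) :=
    measurable_from_top.comp (Int.measurable_floor.comp measurable_fst)
  have h : StronglyMeasurable fun p : ℝ × ℝ => expi (⌊p.1⌋ * p.2) * F (Int.fract p.1, p.2) :=
    .mul (Measurable.stronglyMeasurable (by fun_prop)) (hF.comp_measurable (by fun_prop))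
  exact h.integral_prod_right

theorem ae_memLp_slice (hF : StronglyMeasurable F) (h2 : MemLp F 2 squareMeasure) :
    ∀ᵐ x ∂unitMeasure, MemLp (fun y => F (x, y)) 2 unitMeasure := by
  have h := (memLp_two_iff_lintegral hF.aestronglyMeasurable).1 h2
  rw [lintegral_squareMeasure (hF.enorm.pow_const 2).aemeasurable] at h
  filter_upwards [ae_lt_top' (hF.enorm.pow_const 2).lintegral_prod_right'.aemeasurable h.ne]
    with x hx
  exact (memLp_two_iff_lintegral
    (hF.comp_measurable measurable_prodMk_left).aestronglyMeasurable).2 hx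

theorem lintegral_zakInv (hF : StronglyMeasurable F) (h2 : MemLp F 2 squareMeasure) :
    ∫⁻ t, ‖zakInv F t‖ₑ ^ 2 = ∫⁻ p, ‖F p‖ₑ ^ 2 ∂squareMeasure := by
  have hm (k : ℤ) : AEMeasurable (fun x => ‖zakInv F (x + k)‖ₑ ^ 2) unitMeasure :=
    (((stronglyMeasurable_zakInv hF).comp_measurable
      (measurable_add_const (k : ℝ))).enorm.pow_const 2).aemeasurable
  rw [lintegral_eq_tsum_unitMeasure, lintegral_squareMeasure (hF.enorm.pow_const 2).aemeasurable,
    ← lintegral_tsum hm]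
  refine lintegral_congr_ae ?_
  filter_upwards [ae_unitMeasure_mem, ae_memLp_slice hF h2] with x hx hx2
  rw [← tsum_enorm_integral_expi_sq hx2]
  refine tsum_congr fun k => ?_
  simp only [zakInv, floor_add_of_mem_Ico hx, fract_add_of_mem_Ico hx]

theorem memLp_zakInv (hF : StronglyMeasurable F) (h2 : MemLp F 2 squareMeasure) :
    MemLp (zakInv F) 2 volume := by
  rw [memLp_two_iff_lintegral (stronglyMeasurable_zakInv hF).aestronglyMeasurable,
    lintegral_zakInv hF h2]
  exact (memLp_two_iff_lintegral hF.aestronglyMeasurable).1 h2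

theorem ae_integrable_fract (hF : StronglyMeasurable F) (h2 : MemLp F 2 squareMeasure) :
    ∀ᵐ t : ℝ, Integrable (fun y => expi (⌊t⌋ * y) * F (Int.fract t, y)) unitMeasure := by
  filter_upwards [quasiMeasurePreserving_fract.ae (ae_memLp_slice hF h2)] with t ht
  refine (ht.integrable one_le_two).bdd_mul (c := 1) ?_ (by simp)
  exact Measurable.aestronglyMeasurable (by fun_prop)

theorem zakInv_add_ae {G : ℝ × ℝ → ℂ} (hF : StronglyMeasurable F) (hF2 : MemLp F 2 squareMeasure)
    (hG : StronglyMeasurable G) (hG2 : MemLp G 2 squareMeasure) :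
    zakInv (F + G) =ᵐ[volume] zakInv F + zakInv G := by
  filter_upwards [ae_integrable_fract hF hF2, ae_integrable_fract hG hG2] with t htF htG
  simp only [zakInv, Pi.add_apply, mul_add]
  exact integral_add htF htG

end SquareIntegrable

theorem memLp_zakInv_coeFn (f : Lp ℂ 2 squareMeasure) : MemLp (zakInv f) 2 volume :=
  memLp_zakInv (Lp.stronglyMeasurable f) (Lp.memLp f)

/-- The inverse Zak transform as a linear isometry `L²([0, 1)²) → L²(ℝ)`. -/
noncomputable def zakInvIsometry : Lp ℂ 2 squareMeasure →ₗᵢ[ℂ] L2R where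
  toFun f := (memLp_zakInv_coeFn f).toLp (zakInv f)
  map_add' f g := by
    rw [← MemLp.toLp_add (memLp_zakInv_coeFn f) (memLp_zakInv_coeFn g), MemLp.toLp_eq_toLp_iff]
    exact (zakInv_congr_ae (Lp.coeFn_add f g)).trans (zakInv_add_ae (Lp.stronglyMeasurable f)
      (Lp.memLp f) (Lp.stronglyMeasurable g) (Lp.memLp g))
  map_smul' c f := by
    rw [RingHom.id_apply, ← MemLp.toLp_const_smul c (memLp_zakInv_coeFn f),
      MemLp.toLp_eq_toLp_iff, ← zakInv_smul]
    exact zakInv_congr_ae (Lp.coeFn_smul c f)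
  norm_map' f := by
    have h : ‖(memLp_zakInv_coeFn f).toLp (zakInv f)‖ₑ ^ 2 = ‖f‖ₑ ^ 2 := by
      rw [enorm_toLp_sq, enorm_Lp_sq, lintegral_zakInv (Lp.stronglyMeasurable f) (Lp.memLp f)]
    exact enorm_eq_iff_norm_eq.1 ((ENNReal.pow_right_strictMono two_ne_zero).injective h)

theorem zakInvIsometry_toLp_coeFn {F : ℝ × ℝ → ℂ} (hF : MemLp F 2 squareMeasure) :
    zakInvIsometry (hF.toLp F) =ᵐ[volume] zakInv F :=
  (MemLp.coeFn_toLp (memLp_zakInv_coeFn _)).trans (zakInv_congr_ae hF.coeFn_toLp)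

theorem zakInv_eq_indicator (h : ℝ → ℂ) (m : ℤ) :
    zakInv (fun p => expi (-m * p.2) * h (p.1 + m)) = (Ico (m : ℝ) (m + 1)).indicator h := by
  funext t
  have e (y : ℝ) : expi (⌊t⌋ * y) * (expi (-m * y) * h (Int.fract t + m))
      = expi (((⌊t⌋ - m : ℤ) : ℝ) * y) * h (Int.fract t + m) := by
    rw [← mul_assoc, ← expi_add]
    congr 2
    push_cast
    ring
  simp only [zakInv, e, integral_mul_const, integral_expi_intCast_mul, indicator_apply, mem_Ico,
    sub_eq_zero, ← Int.floor_eq_iff]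
  split_ifs with hm
  · rw [one_mul, ← hm, Int.fract_add_floor]
  · rw [zero_mul]

theorem memLp_expi_mul_translate {h : ℝ → ℂ} (hsm : StronglyMeasurable h)
    (h2 : MemLp h 2 volume) (m : ℤ) :
    MemLp (fun p : ℝ × ℝ => expi (-m * p.2) * h (p.1 + m)) 2 squareMeasure := by
  have hF : StronglyMeasurable fun p : ℝ × ℝ => expi (-m * p.2) * h (p.1 + m) :=
    .mul (Measurable.stronglyMeasurable (by fun_prop)) (hsm.comp_measurable (by fun_prop))
  rw [memLp_two_iff_lintegral hF.aestronglyMeasurable,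
    lintegral_squareMeasure (hF.enorm.pow_const 2).aemeasurable]
  simp only [enorm_mul, enorm_expi, one_mul, lintegral_const, measure_univ, mul_one]
  calc ∫⁻ x, ‖h (x + m)‖ₑ ^ 2 ∂unitMeasure
      ≤ ∑' k : ℤ, ∫⁻ x, ‖h (x + k)‖ₑ ^ 2 ∂unitMeasure :=
        ENNReal.le_tsum (f := fun k : ℤ => ∫⁻ x, ‖h (x + k)‖ₑ ^ 2 ∂unitMeasure) m
    _ = ∫⁻ t, ‖h t‖ₑ ^ 2 := (lintegral_eq_tsum_unitMeasure (fun t => ‖h t‖ₑ ^ 2)).symm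
    _ < ⊤ := (memLp_two_iff_lintegral hsm.aestronglyMeasurable).1 h2

theorem exists_zakInvIsometry_ae_eq_indicator (h : L2R) (m : ℤ) :
    ∃ f, zakInvIsometry f =ᵐ[volume] (Ico (m : ℝ) (m + 1)).indicator h := by
  have hF := memLp_expi_mul_translate (Lp.stronglyMeasurable h) (Lp.memLp h) m
  exact ⟨hF.toLp _, (zakInvIsometry_toLp_coeFn hF).trans (zakInv_eq_indicator h m).eventuallyEq⟩

theorem indicator_ae_eq_zero_of_inner_eq_zero {α : Type*} [MeasurableSpace α] {μ : Measure α}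
    {s : Set α} {u h : Lp ℂ 2 μ} (hu : u =ᵐ[μ] s.indicator h) (h0 : inner ℂ u h = 0) :
    s.indicator h =ᵐ[μ] 0 := by
  have h1 : inner ℂ u u = 0 := by
    rw [← h0, L2.inner_def, L2.inner_def]
    refine integral_congr_ae ?_
    filter_upwards [hu] with t ht
    by_cases hm : t ∈ s <;> simp [ht, hm]
  rw [inner_self_eq_zero.1 h1] at hu
  exact hu.symm.trans (Lp.coeFn_zero ℂ 2 μ)

theorem zakInvIsometry_surjective : Function.Surjective zakInvIsometry := by
  have hclosed : IsClosed (LinearMap.range zakInvIsometry.toLinearMap : Set L2R) := by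
    rw [LinearMap.coe_range]
    exact zakInvIsometry.isometry.isClosedEmbedding.isClosed_range
  have : CompleteSpace (LinearMap.range zakInvIsometry.toLinearMap) := hclosed.completeSpace_coe
  refine LinearMap.range_eq_top.1 (Submodule.orthogonal_eq_bot_iff.1
    ((Submodule.eq_bot_iff _).2 fun h hh => ?_))
  have key (m : ℤ) : (Ico (m : ℝ) (m + 1)).indicator h =ᵐ[volume] 0 := by
    obtain ⟨f, hf⟩ := exists_zakInvIsometry_ae_eq_indicator h m
    exact indicator_ae_eq_zero_of_inner_eq_zero hf
      ((Submodule.mem_orthogonal _ _).1 hh _ ⟨f, rfl⟩)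
  refine (Lp.eq_zero_iff_ae_eq_zero).2 ?_
  filter_upwards [ae_all_iff.2 key] with t ht
  have hmem : t ∈ Ico (⌊t⌋ : ℝ) (⌊t⌋ + 1) := ⟨Int.floor_le t, Int.lt_floor_add_one t⟩
  exact (indicator_of_mem hmem h).symm.trans (ht ⌊t⌋)

/-- The inverse Zak transform as a unitary map from `L²([0, 1)²)` onto `L²(ℝ)`. -/
noncomputable def zakInvEquiv : Lp ℂ 2 squareMeasure ≃ₗᵢ[ℂ] L2R :=
  LinearIsometryEquiv.ofSurjective zakInvIsometry zakInvIsometry_surjective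

theorem zakInvEquiv_toLp_coeFn {F : ℝ × ℝ → ℂ} (hF : MemLp F 2 squareMeasure) :
    zakInvEquiv (hF.toLp F) =ᵐ[volume] zakInv F :=
  zakInvIsometry_toLp_coeFn hF

/-! ### Pointwise identities for limits in `Lᵖ` -/

section LpLimits

variable {α ι : Type*} [MeasurableSpace α] {μ : Measure α} {p : ℝ≥0∞} [Fact (1 ≤ p)]

theorem ae_eq_mul_of_tendsto {l : Filter ι} [l.NeBot] [l.IsCountablyGenerated]
    {u v : ι → Lp ℂ p μ} {u₀ v₀ : Lp ℂ p μ} {f : α → ℂ} (hu : Tendsto u l (𝓝 u₀))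
    (hv : Tendsto v l (𝓝 v₀)) (h : ∀ i, v i =ᵐ[μ] fun x => f x * u i x) :
    v₀ =ᵐ[μ] fun x => f x * u₀ x := by
  obtain ⟨ns, hns, h1⟩ := (tendstoInMeasure_of_tendsto_Lp hu).exists_seq_tendsto_ae'
  obtain ⟨ms, hms, h2⟩ := (tendstoInMeasure_of_tendsto_Lp (hv.comp hns)).exists_seq_tendsto_ae'
  filter_upwards [h1, h2, ae_all_iff.2 fun k => h (ns k)] with x hx1 hx2 hx3
  refine tendsto_nhds_unique hx2 (((hx1.comp hms).const_mul (f x)).congr fun k => ?_)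
  exact (hx3 (ms k)).symm

theorem ae_eq_mul_of_hasSum [Countable ι] {u v : ι → Lp ℂ p μ} {u₀ v₀ : Lp ℂ p μ} {f : α → ℂ}
    (hu : HasSum u u₀) (hv : HasSum v v₀) (h : ∀ i, v i =ᵐ[μ] fun x => f x * u i x) :
    v₀ =ᵐ[μ] fun x => f x * u₀ x := by
  refine ae_eq_mul_of_tendsto hu hv fun t => ?_
  filter_upwards [ae_all_iff.2 h, Lp.coeFn_finsetSum t u, Lp.coeFn_finsetSum t v] with x hx hu hv
  rw [hu, hv, Finset.sum_apply, Finset.sum_apply, Finset.mul_sum]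
  exact Finset.sum_congr rfl fun i _ => hx i

theorem ae_eq_of_hasSum_of_hasSum [Countable ι] {E : Type*} [NormedAddCommGroup E]
    {u : ι → Lp E p μ} {s : Lp E p μ} {f : ι → α → E} {w : α → E} (hu : HasSum u s)
    (hf : ∀ i, u i =ᵐ[μ] f i) (hw : ∀ᵐ x ∂μ, HasSum (fun i => f i x) (w x)) : s =ᵐ[μ] w := by
  obtain ⟨ns, hns, h1⟩ := (tendstoInMeasure_of_tendsto_Lp hu).exists_seq_tendsto_ae'
  have h2 : ∀ᵐ x ∂μ, ∀ k, (∑ i ∈ ns k, u i : Lp E p μ) x = ∑ i ∈ ns k, f i x := by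
    refine ae_all_iff.2 fun k => ?_
    filter_upwards [Lp.coeFn_finsetSum (ns k) u, ae_all_iff.2 hf] with x hx1 hx2
    rw [hx1, Finset.sum_apply]
    exact Finset.sum_congr rfl fun i _ => hx2 i
  filter_upwards [h1, h2, hw] with x hx1 hx2 hx3
  exact tendsto_nhds_unique hx1 ((hx3.comp hns).congr fun k => (hx2 k).symm)

end LpLimits

section Unimodular

variable {α : Type*} [MeasurableSpace α] {μ : Measure α} {F : α → ℂ}

theorem memLp_unimodular_mul {p : ℝ≥0∞} (hF : AEStronglyMeasurable F μ) (h1 : ∀ x, ‖F x‖ = 1)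
    {u : α → ℂ} (hu : MemLp u p μ) : MemLp (fun x => F x * u x) p μ :=
  hu.of_le (hF.mul hu.1) (Eventually.of_forall fun x => by rw [norm_mul, h1, one_mul])

/-- Multiplication by a unimodular function as a unitary operator of `L²`; its inverse is
multiplication by the complex conjugate. -/
noncomputable def unimodularMul (hF : AEStronglyMeasurable F μ) (h1 : ∀ x, ‖F x‖ = 1) :
    Lp ℂ 2 μ ≃ₗᵢ[ℂ] Lp ℂ 2 μ :=
  have hF' : AEStronglyMeasurable (fun x => starRingEnd ℂ (F x)) μ :=
    Complex.continuous_conj.comp_aestronglyMeasurable hF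
  have h1' (x : α) : ‖starRingEnd ℂ (F x)‖ = 1 := by rw [RCLike.norm_conj, h1]
  have hcancel (x : α) : starRingEnd ℂ (F x) * F x = 1 := by
    rw [Complex.conj_mul', h1, Complex.ofReal_one, one_pow]
  { toFun u := (memLp_unimodular_mul hF h1 (Lp.memLp u)).toLp _
    invFun u := (memLp_unimodular_mul hF' h1' (Lp.memLp u)).toLp _
    map_add' u v := by
      rw [← MemLp.toLp_add, MemLp.toLp_eq_toLp_iff]
      filter_upwards [Lp.coeFn_add u v] with x hx
      rw [hx, Pi.add_apply, mul_add]
      rfl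
    map_smul' c u := by
      rw [RingHom.id_apply, ← MemLp.toLp_const_smul, MemLp.toLp_eq_toLp_iff]
      filter_upwards [Lp.coeFn_smul c u] with x hx
      rw [hx, Pi.smul_apply, mul_smul_comm]
      rfl
    left_inv u := by
      refine Lp.ext ((MemLp.coeFn_toLp _).trans ?_)
      filter_upwards [(memLp_unimodular_mul hF h1 (Lp.memLp u)).coeFn_toLp] with x hx
      rw [hx, ← mul_assoc, hcancel, one_mul]
    right_inv u := by
      refine Lp.ext ((MemLp.coeFn_toLp _).trans ?_)
      filter_upwards [(memLp_unimodular_mul hF' h1' (Lp.memLp u)).coeFn_toLp] with x hx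
      rw [hx, ← mul_assoc, mul_comm (F x), hcancel, one_mul]
    norm_map' u := by
      refine (Lp.norm_toLp _ (memLp_unimodular_mul hF h1 (Lp.memLp u))).trans ?_
      rw [Lp.norm_def]
      refine congrArg ENNReal.toReal (eLpNorm_congr_norm_ae (Eventually.of_forall fun x => ?_))
      rw [norm_mul, h1, one_mul] }

theorem unimodularMul_toLp (hF : AEStronglyMeasurable F μ) (h1 : ∀ x, ‖F x‖ = 1) {u : α → ℂ}
    (hu : MemLp u 2 μ) :
    unimodularMul hF h1 (hu.toLp u) = (memLp_unimodular_mul hF h1 hu).toLp _ := by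
  refine (MemLp.toLp_eq_toLp_iff (memLp_unimodular_mul hF h1 (Lp.memLp (hu.toLp u))) _).2 ?_
  filter_upwards [hu.coeFn_toLp] with x hx
  rw [hx]

end Unimodular

/-! ### Characters of the square and Gabor systems -/

section OrthonormalBasis

variable {ι E E' : Type*} [NormedAddCommGroup E] [InnerProductSpace ℂ E]
  [NormedAddCommGroup E'] [InnerProductSpace ℂ E'] {f : ι → E}

theorem IsOrthonormalBasis.map (h : IsOrthonormalBasis f) (e : E ≃ₗᵢ[ℂ] E') :
    IsOrthonormalBasis fun i => e (f i) := by
  refine ⟨h.1.comp_linearIsometryEquiv e, ?_⟩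
  have := e.surjective.denseRange.topologicalClosure_map_submodule
    (f := e.toContinuousLinearEquiv.toContinuousLinearMap) h.2
  rwa [Submodule.map_span, ← range_comp] at this

theorem IsOrthonormalBasis.comp_equiv {κ : Type*} (h : IsOrthonormalBasis f) (e : κ ≃ ι) :
    IsOrthonormalBasis fun k => f (e k) := by
  refine ⟨h.1.comp e e.injective, ?_⟩
  rw [IsCompleteSystem, show range (fun k => f (e k)) = range f from e.surjective.range_comp f]
  exact h.2

end OrthonormalBasis

/-- The character of `ℝ²` by which the Zak transform is multiplied under the time-frequency shift
by `p`. -/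
noncomputable def squareChar (p : ℤ × ℤ) (z : ℝ × ℝ) : ℂ :=
  expi (p.2 * z.1) * expi (-p.1 * z.2)

@[fun_prop] theorem continuous_squareChar (p : ℤ × ℤ) : Continuous (squareChar p) := by
  unfold squareChar; fun_prop

theorem norm_squareChar (p : ℤ × ℤ) (z : ℝ × ℝ) : ‖squareChar p z‖ = 1 := by
  rw [squareChar, norm_mul, norm_expi, norm_expi, one_mul]

theorem memLp_squareChar_mul (p : ℤ × ℤ) {F : ℝ × ℝ → ℂ} (hF : MemLp F 2 squareMeasure) :
    MemLp (fun z => squareChar p z * F z) 2 squareMeasure :=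
  memLp_unimodular_mul (continuous_squareChar p).aestronglyMeasurable (norm_squareChar p) hF

theorem memLp_squareChar (p : ℤ × ℤ) : MemLp (squareChar p) 2 squareMeasure := by
  simpa only [mul_one] using memLp_squareChar_mul p (memLp_const (1 : ℂ))

section Torus

attribute [local instance] instMeasureSpaceUnitAddCircle

instance : IsProbabilityMeasure (volume : Measure UnitAddCircle) :=
  inferInstanceAs (IsProbabilityMeasure AddCircle.haarAddCircle)

theorem measurePreserving_coe_unitAddCircle :
    MeasurePreserving ((↑) : ℝ → UnitAddCircle) unitMeasure volume := by
  have h := AddCircle.measurePreserving_mk 1 0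
  rwa [zero_add, ← unitMeasure_eq_Ioc, AddCircle.volume_eq_smul_haarAddCircle, ENNReal.ofReal_one,
    one_smul] at h

/-- The covering map from the plane to the torus. -/
noncomputable def toTorus (z : ℝ × ℝ) : UnitAddTorus (Fin 2) := ![(z.1 : UnitAddCircle), z.2]

theorem measurePreserving_toTorus : MeasurePreserving toTorus squareMeasure volume :=
  (volume_preserving_finTwoArrow UnitAddCircle).symm.comp
    (measurePreserving_coe_unitAddCircle.prod measurePreserving_coe_unitAddCircle)

/-- The section of the covering map of the torus with values in `[0, 1)²`. -/
noncomputable def ofTorus (θ : UnitAddTorus (Fin 2)) : ℝ × ℝ :=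
  ((AddCircle.equivIco 1 0 (θ 0) : ℝ), (AddCircle.equivIco 1 0 (θ 1) : ℝ))

theorem measurable_ofTorus : Measurable ofTorus := by
  have h : Measurable (fun a : UnitAddCircle => (AddCircle.equivIco 1 0 a : ℝ)) :=
    measurable_subtype_coe.comp (AddCircle.measurableEquivIco 1 0).measurable
  exact (h.comp (measurable_pi_apply 0)).prodMk (h.comp (measurable_pi_apply 1))

theorem ae_squareMeasure_mem :
    ∀ᵐ z ∂squareMeasure, z.1 ∈ Ico (0 : ℝ) 1 ∧ z.2 ∈ Ico (0 : ℝ) 1 := by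
  rw [squareMeasure_eq_restrict]
  exact ae_restrict_mem (measurableSet_Ico.prod measurableSet_Ico)

theorem ofTorus_toTorus_ae : ∀ᵐ z ∂squareMeasure, ofTorus (toTorus z) = z := by
  have h {x : ℝ} (hx : x ∈ Ico (0 : ℝ) 1) :
      (AddCircle.equivIco 1 0 (x : AddCircle (1 : ℝ)) : ℝ) = x := by
    rw [AddCircle.equivIco_coe_of_mem (by simpa using hx)]
  filter_upwards [ae_squareMeasure_mem] with z hz
  exact Prod.ext (h hz.1) (h hz.2)

theorem measurePreserving_ofTorus : MeasurePreserving ofTorus volume squareMeasure := by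
  refine ⟨measurable_ofTorus, ?_⟩
  rw [← measurePreserving_toTorus.map_eq,
    Measure.map_map measurable_ofTorus measurePreserving_toTorus.measurable,
    Measure.map_congr (f := ofTorus ∘ toTorus) (g := id) ofTorus_toTorus_ae, Measure.map_id]

/-- Pullback along the covering map identifies `L²` of the torus with `L²([0, 1)²)`. -/
noncomputable def torusPullback :
    Lp ℂ 2 (volume : Measure (UnitAddTorus (Fin 2))) ≃ₗᵢ[ℂ] Lp ℂ 2 squareMeasure :=
  .ofSurjective (Lp.compMeasurePreservingₗᵢ ℂ toTorus measurePreserving_toTorus) fun f => by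
    refine ⟨Lp.compMeasurePreserving ofTorus measurePreserving_ofTorus f, Lp.ext ?_⟩
    refine (Lp.coeFn_compMeasurePreserving _ measurePreserving_toTorus).trans ?_
    filter_upwards [ofTorus_toTorus_ae, measurePreserving_toTorus.quasiMeasurePreserving.ae
      (Lp.coeFn_compMeasurePreserving f measurePreserving_ofTorus)] with z hz1 hz2
    rw [Function.comp_apply, hz2, Function.comp_apply, hz1]

theorem torusPullback_coeFn (f : Lp ℂ 2 (volume : Measure (UnitAddTorus (Fin 2)))) :
    torusPullback f =ᵐ[squareMeasure] f ∘ toTorus :=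
  Lp.coeFn_compMeasurePreserving f measurePreserving_toTorus

/-- The frequencies on the torus, indexed by the time-frequency shifts they correspond to. -/
def torusFreq : ℤ × ℤ ≃ (Fin 2 → ℤ) where
  toFun p := ![p.2, -p.1]
  invFun v := (-v 1, v 0)
  left_inv p := by simp
  right_inv v := by ext i; fin_cases i <;> simp

theorem torusPullback_mFourierLp (p : ℤ × ℤ) :
    torusPullback (UnitAddTorus.mFourierLp 2 (torusFreq p))
      = (memLp_squareChar p).toLp (squareChar p) := by
  refine Lp.ext ((torusPullback_coeFn _).trans ?_)
  filter_upwards [(memLp_squareChar p).coeFn_toLp,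
    measurePreserving_toTorus.quasiMeasurePreserving.ae
      (UnitAddTorus.coeFn_mFourierLp 2 (torusFreq p))] with z hz1 hz2
  rw [Function.comp_apply, hz2, hz1]
  simp only [UnitAddTorus.mFourier, ContinuousMap.coe_mk, Fin.prod_univ_two, squareChar]
  rw [← fourier_coe_eq_expi p.2, ← Int.cast_neg, ← fourier_coe_eq_expi]
  rfl

theorem isOrthonormalBasis_squareChar :
    IsOrthonormalBasis fun p => (memLp_squareChar p).toLp (squareChar p) := by
  have h : IsOrthonormalBasis (UnitAddTorus.mFourierLp (d := Fin 2) 2) :=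
    ⟨UnitAddTorus.orthonormal_mFourier,
      UnitAddTorus.span_mFourierLp_closure_eq_top ENNReal.ofNat_ne_top⟩
  simpa only [torusPullback_mFourierLp] using (h.comp_equiv torusFreq).map torusPullback

end Torus

/-- The Fourier basis of `L²([0, 1)²)`, indexed by the time-frequency shifts. -/
noncomputable def squareBasis : HilbertBasis (ℤ × ℤ) ℂ (Lp ℂ 2 squareMeasure) :=
  HilbertBasis.mk isOrthonormalBasis_squareChar.1 isOrthonormalBasis_squareChar.2.ge

theorem squareBasis_apply (p : ℤ × ℤ) :
    squareBasis p = (memLp_squareChar p).toLp (squareChar p) := by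
  rw [squareBasis, HilbertBasis.coe_mk]

theorem timeFreqShift_zakInv (F : ℝ × ℝ → ℂ) (p : ℤ × ℤ) :
    timeFreqShift (zakInv F) p.1 p.2 = zakInv fun z => squareChar p z * F z := by
  funext t
  have hfreq : Complex.exp (2 * Real.pi * Complex.I * p.2 * t) = expi (p.2 * Int.fract t) := by
    have h : (p.2 : ℝ) * Int.fract t = p.2 * t + ((-(p.2 * ⌊t⌋) : ℤ) : ℝ) := by
      rw [Int.fract]; push_cast; ring
    rw [h, expi_add_intCast, expi_eq', Complex.ofReal_mul, Complex.ofReal_intCast, mul_assoc]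
  have htime (y : ℝ) : expi (((⌊t⌋ - p.1 : ℤ) : ℝ) * y) = expi (⌊t⌋ * y) * expi (-p.1 * y) := by
    rw [← expi_add]; congr 1; push_cast; ring
  simp only [timeFreqShift, zakInv, hfreq, htime, Int.floor_sub_intCast, Int.fract_sub_intCast,
    squareChar]
  rw [← integral_const_mul]
  exact integral_congr_ae (Eventually.of_forall fun y => by ring)

theorem timeFreqShift_congr_ae {f g : ℝ → ℂ} (h : f =ᵐ[volume] g) (m n : ℤ) :
    timeFreqShift f m n =ᵐ[volume] timeFreqShift g m n := by
  filter_upwards [(measurePreserving_sub_right volume (m : ℝ)).quasiMeasurePreserving.ae h]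
    with t ht
  simp only [timeFreqShift, ht]

theorem gaborSystem_zakInvEquiv {F : ℝ × ℝ → ℂ} (hF : MemLp F 2 squareMeasure) (p : ℤ × ℤ) :
    gaborSystem (zakInvEquiv (hF.toLp F)) p = zakInvEquiv ((memLp_squareChar_mul p hF).toLp _) := by
  refine Lp.ext ((MemLp.coeFn_toLp _).trans (.trans ?_ (zakInvEquiv_toLp_coeFn _).symm))
  rw [← timeFreqShift_zakInv]
  exact timeFreqShift_congr_ae (zakInvEquiv_toLp_coeFn hF) _ _

theorem isOrthonormalBasis_gaborSystem {F : ℝ × ℝ → ℂ} (hF : MemLp F 2 squareMeasure)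
    (h1 : ∀ z, ‖F z‖ = 1) : IsOrthonormalBasis (gaborSystem (zakInvEquiv (hF.toLp F))) := by
  have hbasis := isOrthonormalBasis_squareChar.map ((unimodularMul hF.1 h1).trans zakInvEquiv)
  simp only [LinearIsometryEquiv.trans_apply, unimodularMul_toLp] at hbasis
  convert hbasis using 2 with p
  rw [gaborSystem_zakInvEquiv]
  simp only [mul_comm]

/-! ### Riesz sequences -/

/-- `f` is a Riesz sequence of `H` with (not necessarily optimal) bounds `A` and `B`: the
inequalities of a Riesz basis, without completeness. -/
def IsRieszSequenceWithBounds {ι H : Type*} [NormedAddCommGroup H] [InnerProductSpace ℂ H]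
    (f : ι → H) (A B : ℝ) : Prop :=
  0 < A ∧ 0 < B ∧ ∀ a : ι → ℂ, Summable (fun i => ‖a i‖ ^ 2) →
    ∃ s : H, HasSum (fun i => a i • f i) s ∧
      A * ∑' i, ‖a i‖ ^ 2 ≤ ‖s‖ ^ 2 ∧ ‖s‖ ^ 2 ≤ B * ∑' i, ‖a i‖ ^ 2

theorem IsRieszBasisWithBounds.isRieszSequenceWithBounds {ι H : Type*} [NormedAddCommGroup H]
    [InnerProductSpace ℂ H] {f : ι → H} {A B : ℝ} (h : IsRieszBasisWithBounds f A B) :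
    IsRieszSequenceWithBounds f A B :=
  ⟨h.1, h.2.1, h.2.2.2⟩

section RieszSequence

variable {F : ℝ × ℝ → ℂ} {hF : MemLp F 2 squareMeasure} {A B : ℝ}

theorem exists_ae_eq_mul_of_isRieszSequenceWithBounds
    (h : IsRieszSequenceWithBounds (gaborSystem (zakInvEquiv (hF.toLp F))) A B)
    (u : Lp ℂ 2 squareMeasure) :
    ∃ v : Lp ℂ 2 squareMeasure, v =ᵐ[squareMeasure] (fun z => F z * u z) ∧
      A * ‖u‖ ^ 2 ≤ ‖v‖ ^ 2 ∧ ‖v‖ ^ 2 ≤ B * ‖u‖ ^ 2 := by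
  have hnorm : HasSum (fun p => ‖squareBasis.repr u p‖ ^ 2) (‖u‖ ^ 2) := by
    simpa using lp.hasSum_norm (p := 2) (by simp) (squareBasis.repr u)
  obtain ⟨s, hs, hA, hB⟩ := h.2.2 _ hnorm.summable
  rw [hnorm.tsum_eq] at hA hB
  have hs' : HasSum (fun p => squareBasis.repr u p • (memLp_squareChar_mul p hF).toLp _)
      (zakInvEquiv.symm s) := by
    simpa [gaborSystem_zakInvEquiv] using
      hs.mapL zakInvEquiv.symm.toContinuousLinearEquiv.toContinuousLinearMap
  refine ⟨zakInvEquiv.symm s, ae_eq_mul_of_hasSum (squareBasis.hasSum_repr u) hs' fun p => ?_, ?_⟩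
  · filter_upwards [Lp.coeFn_smul (squareBasis.repr u p) (squareBasis p),
      Lp.coeFn_smul (squareBasis.repr u p) ((memLp_squareChar_mul p hF).toLp _),
      (memLp_squareChar p).coeFn_toLp, (memLp_squareChar_mul p hF).coeFn_toLp] with z h1 h2 h3 h4
    rw [h1, h2, Pi.smul_apply, Pi.smul_apply, squareBasis_apply, h3, h4, smul_eq_mul, smul_eq_mul]
    ring
  · rw [zakInvEquiv.symm.norm_map]
    exact ⟨hA, hB⟩

theorem setLIntegral_bounds_of_isRieszSequenceWithBounds
    (h : IsRieszSequenceWithBounds (gaborSystem (zakInvEquiv (hF.toLp F))) A B)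
    {E : Set (ℝ × ℝ)} (hE : MeasurableSet E) :
    ENNReal.ofReal A * squareMeasure E ≤ ∫⁻ z in E, ‖F z‖ₑ ^ 2 ∂squareMeasure ∧
      ∫⁻ z in E, ‖F z‖ₑ ^ 2 ∂squareMeasure ≤ ENNReal.ofReal B * squareMeasure E := by
  let u : Lp ℂ 2 squareMeasure := indicatorConstLp 2 hE (measure_ne_top _ _) (1 : ℂ)
  have hu : ∀ᵐ z ∂squareMeasure, u z = E.indicator (fun _ => 1) z := indicatorConstLp_coeFn
  obtain ⟨v, hv, hA, hB⟩ := exists_ae_eq_mul_of_isRieszSequenceWithBounds h u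
  have hu2 : ENNReal.ofReal (‖u‖ ^ 2) = squareMeasure E := by
    rw [ENNReal.ofReal_pow (norm_nonneg _), ofReal_norm, enorm_Lp_sq, ← lintegral_indicator_one hE]
    refine lintegral_congr_ae ?_
    filter_upwards [hu] with z hz
    by_cases hzE : z ∈ E <;> simp [hz, hzE]
  have hv2 : ENNReal.ofReal (‖v‖ ^ 2) = ∫⁻ z in E, ‖F z‖ₑ ^ 2 ∂squareMeasure := by
    rw [ENNReal.ofReal_pow (norm_nonneg _), ofReal_norm, enorm_Lp_sq, ← lintegral_indicator hE]
    refine lintegral_congr_ae ?_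
    filter_upwards [hv, hu] with z hz1 hz2
    by_cases hzE : z ∈ E <;> simp [hz1, hz2, hzE]
  rw [← hv2, ← hu2, ← ENNReal.ofReal_mul h.1.le, ← ENNReal.ofReal_mul h.2.1.le]
  exact ⟨ENNReal.ofReal_le_ofReal hA, ENNReal.ofReal_le_ofReal hB⟩

theorem ae_bounds_of_isRieszSequenceWithBounds (hFm : Measurable F)
    (h : IsRieszSequenceWithBounds (gaborSystem (zakInvEquiv (hF.toLp F))) A B) :
    ∀ᵐ z ∂squareMeasure, A ≤ ‖F z‖ ^ 2 ∧ ‖F z‖ ^ 2 ≤ B := by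
  have hA : ∀ᵐ z ∂squareMeasure, ENNReal.ofReal A ≤ ‖F z‖ₑ ^ 2 :=
    ae_le_of_forall_setLIntegral_le_of_sigmaFinite measurable_const fun E hE _ => by
      simpa using (setLIntegral_bounds_of_isRieszSequenceWithBounds h hE).1
  have hB : ∀ᵐ z ∂squareMeasure, ‖F z‖ₑ ^ 2 ≤ ENNReal.ofReal B :=
    ae_le_of_forall_setLIntegral_le_of_sigmaFinite (hFm.enorm.pow_const 2) fun E hE _ => by
      simpa using (setLIntegral_bounds_of_isRieszSequenceWithBounds h hE).2
  filter_upwards [hA, hB] with z hzA hzB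
  rw [← ofReal_norm, ← ENNReal.ofReal_pow (norm_nonneg _)] at hzA hzB
  exact ⟨(ENNReal.ofReal_le_ofReal_iff (by positivity)).1 hzA,
    (ENNReal.ofReal_le_ofReal_iff h.2.1.le).1 hzB⟩

end RieszSequence

/-! ### Translations and the Fourier transform -/

/-- Translation by `s` on `L²(ℝ)`: `(timeTranslate s g)(t) = g(t + s)`. -/
noncomputable def timeTranslate (s : ℝ) : L2R →ₗᵢ[ℂ] L2R :=
  Lp.compMeasurePreservingₗᵢ ℂ (fun t => t + s) (measurePreserving_add_right volume s)

theorem timeTranslate_coeFn (s : ℝ) (g : L2R) : timeTranslate s g =ᵐ[volume] fun t => g (t + s) :=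
  Lp.coeFn_compMeasurePreserving g (measurePreserving_add_right volume s)

theorem timeTranslate_congr_ae (s : ℝ) {f : L2R} {g : ℝ → ℂ} (h : f =ᵐ[volume] g) :
    timeTranslate s f =ᵐ[volume] fun t => g (t + s) :=
  (timeTranslate_coeFn s f).trans
    ((measurePreserving_add_right volume s).quasiMeasurePreserving.ae h)

theorem fourier_comp_add_right (f : ℝ → ℂ) (s ξ : ℝ) :
    𝓕 (fun t => f (t + s)) ξ = expi (s * ξ) * 𝓕 f ξ :=
  (congrFun (VectorFourier.fourierIntegral_comp_add_right 𝐞 volume (innerₗ ℝ) f s) ξ).trans <| by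
    simp [Circle.smul_def, expi, mul_comm, Real.fourier_eq, VectorFourier.fourierIntegral]

theorem timeTranslate_toLp_schwartz (s : ℝ) (ψ : SchwartzMap ℝ ℂ) :
    timeTranslate s (ψ.toLp 2) = (ψ.compSubConstCLM ℂ (-s)).toLp 2 := by
  refine Lp.ext ?_
  filter_upwards [timeTranslate_congr_ae s (ψ.coeFn_toLp 2 volume),
    (ψ.compSubConstCLM ℂ (-s)).coeFn_toLp 2] with t h1 h2
  rw [h1, h2, SchwartzMap.compSubConstCLM_apply, sub_neg_eq_add]

theorem fourier_timeTranslate_toLp_schwartz (s : ℝ) (ψ : SchwartzMap ℝ ℂ) :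
    (𝓕 (timeTranslate s (ψ.toLp 2)) : L2R) =ᵐ[volume]
      fun ξ => expi (s * ξ) * (𝓕 (ψ.toLp 2) : L2R) ξ := by
  have htranslate : ⇑(ψ.compSubConstCLM ℂ (-s)) = fun t => ψ (t + s) :=
    funext fun t => by rw [SchwartzMap.compSubConstCLM_apply, sub_neg_eq_add]
  rw [timeTranslate_toLp_schwartz, SchwartzMap.toLp_fourier_eq, SchwartzMap.toLp_fourier_eq]
  filter_upwards [(𝓕 ψ).coeFn_toLp 2, (𝓕 (ψ.compSubConstCLM ℂ (-s))).coeFn_toLp 2] with ξ h1 h2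
  rw [h1, h2, SchwartzMap.fourier_coe, SchwartzMap.fourier_coe, htranslate, fourier_comp_add_right]

theorem fourier_timeTranslate (s : ℝ) (g : L2R) :
    (𝓕 (timeTranslate s g) : L2R) =ᵐ[volume] fun ξ => expi (s * ξ) * (𝓕 g : L2R) ξ := by
  obtain ⟨φ, hφ, hlim⟩ := mem_closure_iff_seq_limit.1 ((SchwartzMap.denseRange_toLpCLM (E := ℝ)
    (F := ℂ) (μ := volume) (p := 2) ENNReal.ofNat_ne_top) g)
  have hc : Continuous fun f : L2R => (𝓕 f : L2R) := (Lp.fourierTransformₗᵢ ℝ ℂ).continuous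
  refine ae_eq_mul_of_tendsto (l := atTop) ((hc.tendsto g).comp hlim)
    (((hc.comp (timeTranslate s).continuous).tendsto g).comp hlim) fun n => ?_
  obtain ⟨ψ, hψ⟩ := hφ n
  simp only [Function.comp_apply, ← hψ]
  exact fourier_timeTranslate_toLp_schwartz s ψ

section TranslateSum

variable {ι : Type*} {c : ι → ℂ}

theorem summable_smul_timeTranslate (hc : Summable fun j => ‖c j‖) (s : ι → ℝ) (g : L2R) :
    Summable fun j => c j • timeTranslate (s j) g := by
  refine Summable.of_norm ?_
  simpa [norm_smul] using hc.mul_right ‖g‖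

variable [Countable ι]

theorem tsum_smul_timeTranslate_ae_eq (hc : Summable fun j => ‖c j‖) (s : ι → ℝ) {g : ℝ → ℂ}
    (hg : MemLp g 2 volume) {K : ℝ} (hK : ∀ t, ‖g t‖ ≤ K) :
    (∑' j, c j • timeTranslate (s j) (hg.toLp g) : L2R) =ᵐ[volume]
      fun t => ∑' j, c j * g (t + s j) := by
  refine ae_eq_of_hasSum_of_hasSum (f := fun j t => c j * g (t + s j))
    (summable_smul_timeTranslate hc s _).hasSum (fun j => ?_) (Eventually.of_forall fun t => ?_)
  · filter_upwards [Lp.coeFn_smul (c j) (timeTranslate (s j) (hg.toLp g)),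
      timeTranslate_congr_ae (s j) hg.coeFn_toLp] with t h1 h2
    rw [h1, Pi.smul_apply, h2, smul_eq_mul]
  · refine (Summable.of_norm_bounded (hc.mul_right K) fun j => ?_).hasSum
    rw [norm_mul]
    exact mul_le_mul_of_nonneg_left (hK _) (norm_nonneg _)

theorem fourier_tsum_smul_timeTranslate_ae_eq (hc : Summable fun j => ‖c j‖) (s : ι → ℝ) (g : L2R) :
    (𝓕 (∑' j, c j • timeTranslate (s j) g : L2R) : L2R) =ᵐ[volume]
      fun ξ => (∑' j, c j * expi (s j * ξ)) * (𝓕 g : L2R) ξ := by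
  have hs : HasSum (fun j => c j • (𝓕 (timeTranslate (s j) g) : L2R))
      (𝓕 (∑' j, c j • timeTranslate (s j) g : L2R)) := by
    have := (summable_smul_timeTranslate hc s g).hasSum.mapL
      (Lp.fourierTransformₗᵢ ℝ ℂ).toContinuousLinearEquiv.toContinuousLinearMap
    simp only [map_smul] at this
    exact this
  refine ae_eq_of_hasSum_of_hasSum
    (f := fun j ξ => (c j * expi (s j * ξ)) * (𝓕 g : L2R) ξ) hs (fun j => ?_)
    (Eventually.of_forall fun ξ => ?_)
  · filter_upwards [Lp.coeFn_smul (c j) (𝓕 (timeTranslate (s j) g) : L2R),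
      fourier_timeTranslate (s j) g] with ξ h1 h2
    rw [h1, Pi.smul_apply, h2, smul_eq_mul, mul_assoc]
  · refine (Summable.hasSum ?_).mul_right _
    exact Summable.of_norm (by simpa using hc)

theorem lintegral_tsum_translate {g : ℝ → ℂ} (hg : MemLp g 2 volume) {K : ℝ}
    (hK : ∀ t, ‖g t‖ ≤ K) (hc : Summable fun j => ‖c j‖) (s : ι → ℝ) :
    ∫⁻ t, ‖∑' j, c j * g (t + s j)‖ₑ ^ 2
      = ∫⁻ ξ, ‖∑' j, c j * expi (s j * ξ)‖ₑ ^ 2 * ‖(𝓕 (hg.toLp g) : L2R) ξ‖ₑ ^ 2 := by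
  set S : L2R := ∑' j, c j • timeTranslate (s j) (hg.toLp g)
  calc ∫⁻ t, ‖∑' j, c j * g (t + s j)‖ₑ ^ 2
      = ∫⁻ t, ‖S t‖ₑ ^ 2 := lintegral_congr_ae <| by
        filter_upwards [tsum_smul_timeTranslate_ae_eq hc s hg hK] with t ht
        rw [ht]
    _ = ∫⁻ ξ, ‖(𝓕 S : L2R) ξ‖ₑ ^ 2 := by
        rw [← enorm_Lp_sq, ← enorm_Lp_sq, ← ofReal_norm, ← ofReal_norm, Lp.norm_fourier_eq]
    _ = _ := lintegral_congr_ae <| by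
        filter_upwards [fourier_tsum_smul_timeTranslate_ae_eq hc s (hg.toLp g)] with ξ hξ
        rw [hξ, enorm_mul, mul_pow]

end TranslateSum

/-! ### Fourier series with small Wiener norm -/

theorem norm_expi_sub_one_le (t : ℝ) : ‖expi t - 1‖ ≤ 2 * Real.pi * |t| := by
  rw [expi_eq, mul_comm]
  refine Real.norm_exp_I_mul_ofReal_sub_one_le.trans_eq ?_
  rw [Real.norm_eq_abs, abs_mul, abs_of_pos Real.two_pi_pos]

section WienerNorm

variable {a : ℝ} {w w' : ℝ → ℂ}

theorem norm_fourierCoeffOn_le_of_norm_le {D : ℝ} (hD : ∀ x, ‖w x‖ ≤ D) (n : ℤ) :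
    ‖fourierCoeffOn (lt_add_one a) w n‖ ≤ D := by
  rw [fourierCoeffOn_eq_integral, add_sub_cancel_left, div_one, one_smul]
  refine (intervalIntegral.norm_integral_le_of_norm_le_const (C := D) fun x _ => ?_).trans_eq ?_
  · rw [norm_smul, fourier_apply, Circle.norm_coe, one_mul]
    exact hD x
  · rw [add_sub_cancel_left, abs_one, mul_one]

theorem norm_fourierCoeffOn_le_of_hasDerivAt (hw : ∀ x, HasDerivAt w (w' x) x)
    (hw' : Continuous w') (hper : w (a + 1) = w a) {n : ℤ} (hn : n ≠ 0) :
    ‖fourierCoeffOn (lt_add_one a) w n‖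
      ≤ ‖fourierCoeffOn (lt_add_one a) w' n‖ * (1 / |(n : ℝ)|) := by
  have hn' : 0 < |(n : ℝ)| := abs_pos.2 (Int.cast_ne_zero.2 hn)
  rw [fourierCoeffOn_of_hasDerivAt (lt_add_one a) hn (fun x _ => hw x)
    (hw'.intervalIntegrable _ _), hper, sub_self, mul_zero, zero_sub, ← Complex.ofReal_sub,
    add_sub_cancel_left, Complex.ofReal_one, one_mul, norm_mul, norm_neg, mul_comm]
  refine mul_le_mul_of_nonneg_left ?_ (norm_nonneg _)
  have hden : ‖-2 * (Real.pi : ℂ) * Complex.I * n‖ = 2 * Real.pi * |(n : ℝ)| := by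
    simp [abs_of_pos Real.pi_pos]
  rw [norm_div, norm_one, hden]
  refine one_div_le_one_div_of_le hn' (le_mul_of_one_le_left hn'.le ?_)
  linarith [Real.pi_gt_three]

theorem hasSum_norm_sq_fourierCoeffOn_of_continuous (hw : Continuous w) :
    HasSum (fun n => ‖fourierCoeffOn (lt_add_one a) w n‖ ^ 2) (∫ x in a..a + 1, ‖w x‖ ^ 2) := by
  have h := hasSum_sq_fourierCoeffOn (f := w) (lt_add_one a)
    ((memLp_two_iff_integrable_sq_norm hw.aestronglyMeasurable).2 (hw.norm.pow 2).integrableOn_Ioc)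
  rwa [add_sub_cancel_left, inv_one, one_smul] at h

theorem norm_fourierCoeffOn_le_sq_add_sq (hw : ∀ x, HasDerivAt w (w' x) x) (hw' : Continuous w')
    (hper : w (a + 1) = w a) {η : ℝ} (hη : 0 < η) (n : ℤ) :
    ‖fourierCoeffOn (lt_add_one a) w n‖ ≤ (if n = 0 then ‖fourierCoeffOn (lt_add_one a) w 0‖ else 0)
      + η * (1 / (n : ℝ) ^ 2) + η⁻¹ * ‖fourierCoeffOn (lt_add_one a) w' n‖ ^ 2 := by
  rcases eq_or_ne n 0 with rfl | hn
  · rw [if_pos rfl, add_assoc]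
    exact le_add_of_nonneg_right (by positivity)
  rw [if_neg hn, zero_add, ← sq_abs (n : ℝ), ← one_div_pow]
  refine (norm_fourierCoeffOn_le_of_hasDerivAt hw hw' hper hn).trans ?_
  set y := 1 / |(n : ℝ)|
  set c := ‖fourierCoeffOn (lt_add_one a) w' n‖
  have hy : 0 ≤ y := by positivity
  have amgm : η * y ^ 2 + η⁻¹ * c ^ 2 - 2 * (c * y) = η⁻¹ * (η * y - c) ^ 2 := by
    field_simp; ring
  have : 0 ≤ η⁻¹ * (η * y - c) ^ 2 := by positivity
  have : 0 ≤ c * y := mul_nonneg (norm_nonneg _) hy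
  linarith

-- Bernstein's trick: `|ŵ(n)| ≤ |ŵ'(n)| / |n|`, then AM-GM with weight `η` and Parseval for `w'`.
theorem summable_and_tsum_norm_fourierCoeffOn_le (hw : ∀ x, HasDerivAt w (w' x) x)
    (hw' : Continuous w') (hper : w (a + 1) = w a) {η : ℝ} (hη : 0 < η) :
    (Summable fun n => ‖fourierCoeffOn (lt_add_one a) w n‖) ∧
      ∑' n, ‖fourierCoeffOn (lt_add_one a) w n‖ ≤ ‖fourierCoeffOn (lt_add_one a) w 0‖
        + η * ∑' n : ℤ, 1 / (n : ℝ) ^ 2 + η⁻¹ * ∫ x in a..a + 1, ‖w' x‖ ^ 2 := by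
  have hbound := norm_fourierCoeffOn_le_sq_add_sq hw hw' hper hη
  have hmajorant := ((hasSum_ite_eq 0 ‖fourierCoeffOn (lt_add_one a) w 0‖).add
    ((Real.summable_one_div_int_pow.2 one_lt_two).hasSum.mul_left η)).add
    ((hasSum_norm_sq_fourierCoeffOn_of_continuous (a := a) hw').mul_left η⁻¹)
  have hs := Summable.of_nonneg_of_le (fun _ => norm_nonneg _) hbound hmajorant.summable
  exact ⟨hs, hasSum_le hbound hs.hasSum hmajorant⟩

theorem hasSum_fourierCoeffOn_mul_expi (hw : Continuous w) (hper : w (a + 1) = w a)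
    (hs : Summable fun n => ‖fourierCoeffOn (lt_add_one a) w n‖) {θ : ℝ}
    (hθ : θ ∈ Ico a (a + 1)) :
    HasSum (fun n : ℤ => fourierCoeffOn (lt_add_one a) w n * expi (n * θ)) (w θ) := by
  let f : C(AddCircle (1 : ℝ), ℂ) := ⟨AddCircle.liftIco 1 a w,
    AddCircle.liftIco_continuous hper.symm hw.continuousOn⟩
  have hcoeff : fourierCoeff f = fourierCoeffOn (lt_add_one a) w :=
    funext fun n => fourierCoeff_liftIco_eq w n
  have hvalue : f θ = w θ := AddCircle.liftIco_coe_apply hθ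
  have h := has_pointwise_sum_fourier_series_of_summable (f := f) (hcoeff ▸ hs.of_norm) θ
  simpa only [hcoeff, hvalue, fourier_coe_eq_expi, smul_eq_mul] using h

end WienerNorm

/-- A smooth bump equal to `1` on `[-1, 1]` and vanishing outside `[-2, 2]`. -/
def unitBump : ContDiffBump (0 : ℝ) := ⟨1, 2, one_pos, one_lt_two⟩

/-- The function `θ ↦ e^{2πiθ} - 1`, cut off smoothly to `[-2δ, 2δ]`. -/
noncomputable def localizedExpi (δ θ : ℝ) : ℂ := (expi θ - 1) * (unitBump (θ / δ) : ℝ)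

section LocalizedExpi

variable {δ : ℝ}

theorem contDiff_localizedExpi (δ : ℝ) : ContDiff ℝ 1 (localizedExpi δ) := by
  have hbump : ContDiff ℝ 1 fun θ => unitBump (θ / δ) :=
    (unitBump.contDiff (n := 1)).comp (contDiff_id.div_const δ)
  have hexpi : ContDiff ℝ 1 expi := by
    simp only [funext expi_eq']
    exact (contDiff_const.mul Complex.ofRealCLM.contDiff).cexp
  exact (hexpi.sub contDiff_const).mul (Complex.ofRealCLM.contDiff.comp hbump)

theorem localizedExpi_of_abs_le (hδ : 0 < δ) {θ : ℝ} (hθ : |θ| ≤ δ) :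
    localizedExpi δ θ = expi θ - 1 := by
  have : θ / δ ∈ Metric.closedBall (0 : ℝ) 1 := by
    rwa [mem_closedBall_zero_iff, Real.norm_eq_abs, abs_div, abs_of_pos hδ, div_le_one hδ]
  rw [localizedExpi, unitBump.one_of_mem_closedBall this, Complex.ofReal_one, mul_one]

theorem localizedExpi_eq_zero (hδ : 0 < δ) {θ : ℝ} (hθ : 2 * δ ≤ |θ|) :
    localizedExpi δ θ = 0 := by
  have : 2 ≤ dist (θ / δ) 0 := by
    rwa [dist_zero_right, Real.norm_eq_abs, abs_div, abs_of_pos hδ, le_div_iff₀ hδ]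
  rw [localizedExpi, unitBump.zero_of_le_dist this, Complex.ofReal_zero, mul_zero]

theorem deriv_localizedExpi_eq_zero (hδ : 0 < δ) {θ : ℝ} (hθ : 2 * δ < |θ|) :
    deriv (localizedExpi δ) θ = 0 := by
  have : localizedExpi δ =ᶠ[𝓝 θ] fun _ => 0 := by
    filter_upwards [(isOpen_lt continuous_const continuous_abs).mem_nhds hθ] with y hy
    exact localizedExpi_eq_zero hδ (le_of_lt hy)
  rw [this.deriv_eq, deriv_const]

theorem norm_localizedExpi_le (hδ : 0 < δ) (θ : ℝ) : ‖localizedExpi δ θ‖ ≤ 4 * Real.pi * δ := by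
  rcases le_total (2 * δ) |θ| with hθ | hθ
  · rw [localizedExpi_eq_zero hδ hθ, norm_zero]
    positivity
  · rw [localizedExpi, norm_mul, Complex.norm_real, Real.norm_of_nonneg unitBump.nonneg]
    calc ‖expi θ - 1‖ * unitBump (θ / δ) ≤ ‖expi θ - 1‖ :=
          mul_le_of_le_one_right (norm_nonneg _) unitBump.le_one
      _ ≤ 2 * Real.pi * |θ| := norm_expi_sub_one_le θ
      _ ≤ 2 * Real.pi * (2 * δ) := by gcongr
      _ = 4 * Real.pi * δ := by ring

theorem hasDerivAt_localizedExpi (δ θ : ℝ) :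
    HasDerivAt (localizedExpi δ) (2 * Real.pi * Complex.I * expi θ * (unitBump (θ / δ) : ℝ)
      + (expi θ - 1) * (deriv unitBump (θ / δ) * (1 / δ) : ℝ)) θ := by
  have hexpi : HasDerivAt expi (2 * Real.pi * Complex.I * expi θ) θ := by
    have h := ((Complex.ofRealCLM.hasDerivAt (x := θ)).const_mul (2 * Real.pi * Complex.I)).cexp
    simp only [Complex.ofRealCLM_apply, ← expi_eq', Complex.ofReal_one, mul_one] at h
    rwa [mul_comm] at h
  have hbump : HasDerivAt (fun θ : ℝ => unitBump (θ / δ)) (deriv unitBump (θ / δ) * (1 / δ)) θ :=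
    ((unitBump.contDiff (n := 1)).differentiable one_ne_zero _).hasDerivAt.comp θ
      ((hasDerivAt_id θ).div_const δ)
  exact (hexpi.sub_const 1).mul hbump.ofReal_comp

theorem exists_norm_deriv_localizedExpi_le :
    ∃ D : ℝ, ∀ δ > 0, ∀ θ, ‖deriv (localizedExpi δ) θ‖ ≤ D := by
  obtain ⟨C, hC⟩ := unitBump.hasCompactSupport.deriv.exists_bound_of_continuous
    ((unitBump.contDiff (n := 1)).continuous_deriv le_rfl)
  have hC0 : 0 ≤ C := (norm_nonneg _).trans (hC 0)
  refine ⟨2 * Real.pi + 4 * Real.pi * C, fun δ hδ θ => ?_⟩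
  rcases lt_or_ge (2 * δ) |θ| with hθ | hθ
  · rw [deriv_localizedExpi_eq_zero hδ hθ, norm_zero]
    positivity
  rw [(hasDerivAt_localizedExpi δ θ).deriv]
  refine (norm_add_le _ _).trans (add_le_add ?_ ?_)
  · simp only [norm_mul, Complex.norm_real, Real.norm_of_nonneg unitBump.nonneg, norm_expi,
      Complex.norm_I, Complex.norm_ofNat, mul_one, Real.norm_of_nonneg Real.pi_pos.le]
    exact mul_le_of_le_one_right (by positivity) unitBump.le_one
  · rw [norm_mul, Complex.norm_real, norm_mul, Real.norm_of_nonneg (one_div_pos.2 hδ).le]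
    calc ‖expi θ - 1‖ * (‖deriv unitBump (θ / δ)‖ * (1 / δ))
        ≤ 2 * Real.pi * (2 * δ) * (C * (1 / δ)) := by
          gcongr
          · exact (norm_expi_sub_one_le θ).trans (by gcongr)
          · exact hC _
      _ = 4 * Real.pi * C := by field_simp; ring

end LocalizedExpi

theorem intervalIntegral_norm_sq_le_of_support {E : Type*} [NormedAddCommGroup E] {w : ℝ → E}
    {δ D : ℝ} (hδ : 0 ≤ δ) (hw : Continuous w) (hD : ∀ x, ‖w x‖ ≤ D)
    (h0 : ∀ x, δ < |x| → w x = 0) {a b : ℝ} (hab : a ≤ b) :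
    ∫ x in a..b, ‖w x‖ ^ 2 ≤ D ^ 2 * (2 * δ) := by
  have hi : Integrable ((Icc (-δ) δ).indicator fun _ : ℝ => D ^ 2) volume :=
    (integrable_indicator_iff measurableSet_Icc).2 (integrableOn_const (by simp))
  rw [intervalIntegral.integral_of_le hab]
  calc ∫ x in Ioc a b, ‖w x‖ ^ 2
      ≤ ∫ x in Ioc a b, (Icc (-δ) δ).indicator (fun _ : ℝ => D ^ 2) x := by
        refine integral_mono (hw.norm.pow 2).integrableOn_Ioc hi.integrableOn fun x => ?_
        refine le_indicator (f := fun x => ‖w x‖ ^ 2) (fun x _ => ?_) (fun x hx => ?_) x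
        · exact pow_le_pow_left₀ (norm_nonneg _) (hD x) 2
        · rw [h0 x (not_le.1 fun h => hx (abs_le.1 h)), norm_zero, zero_pow two_ne_zero]
    _ ≤ ∫ x, (Icc (-δ) δ).indicator (fun _ : ℝ => D ^ 2) x :=
        setIntegral_le_integral hi
          (Eventually.of_forall (indicator_nonneg fun _ _ => sq_nonneg D))
    _ = D ^ 2 * (2 * δ) := by
        rw [integral_indicator measurableSet_Icc, setIntegral_const,
          Real.volume_real_Icc_of_le (by linarith), smul_eq_mul]
        ring

theorem exists_small_fourierSeries_eq_expi_sub_one {ε : ℝ} (hε : 0 < ε) :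
    ∃ δ : ℝ, 0 < δ ∧ ∃ d : ℤ → ℂ, Summable (fun j => ‖d j‖) ∧ ∑' j, ‖d j‖ ≤ ε ∧
      ∀ θ : ℝ, |θ| ≤ δ → HasSum (fun j : ℤ => d j * expi (j * θ)) (expi θ - 1) := by
  obtain ⟨D, hD⟩ := exists_norm_deriv_localizedExpi_le
  set Z : ℝ := ∑' n : ℤ, 1 / (n : ℝ) ^ 2
  have : 0 ≤ Z := tsum_nonneg fun n => by positivity
  have hK : 0 < 4 * Real.pi + Z + 4 * D ^ 2 := by positivity
  obtain ⟨η, hη0, hη4, hηε⟩ : ∃ η : ℝ, 0 < η ∧ η ≤ 1 / 4 ∧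
      η * (4 * Real.pi + Z + 4 * D ^ 2) ≤ ε :=
    ⟨min (1 / 4) (ε / (4 * Real.pi + Z + 4 * D ^ 2)), by positivity, min_le_left _ _,
      (le_div_iff₀ hK).1 (min_le_right _ _)⟩
  have hδ : 0 < η ^ 2 := by positivity
  have hδη : η ^ 2 ≤ η / 4 := by nlinarith
  set w : ℝ → ℂ := localizedExpi (η ^ 2)
  have hw : ContDiff ℝ 1 w := contDiff_localizedExpi _
  have hw' : Continuous (deriv w) := hw.continuous_deriv le_rfl
  have hper : w (-(1 / 2) + 1) = w (-(1 / 2)) := by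
    have hend (θ : ℝ) (hθ : |θ| = 1 / 2) : w θ = 0 :=
      localizedExpi_eq_zero hδ (by rw [hθ]; linarith)
    rw [hend _ (by norm_num), hend _ (by norm_num)]
  obtain ⟨hs, hle⟩ := summable_and_tsum_norm_fourierCoeffOn_le
    (fun x => (hw.differentiable one_ne_zero x).hasDerivAt) hw' hper hη0
  refine ⟨η ^ 2, hδ, fourierCoeffOn (lt_add_one (-(1 / 2))) w, hs, hle.trans ?_, fun θ hθ => ?_⟩
  · calc ‖fourierCoeffOn (lt_add_one (-(1 / 2))) w 0‖ + η * Z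
          + η⁻¹ * ∫ x in -(1 / 2)..-(1 / 2) + 1, ‖deriv w x‖ ^ 2
        ≤ 4 * Real.pi * η ^ 2 + η * Z + η⁻¹ * (D ^ 2 * (2 * (2 * η ^ 2))) := by
          gcongr
          · exact norm_fourierCoeffOn_le_of_norm_le (norm_localizedExpi_le hδ) 0
          · exact intervalIntegral_norm_sq_le_of_support (by positivity) hw' (hD _ hδ)
              (fun x hx => deriv_localizedExpi_eq_zero hδ hx) (lt_add_one _).le
      _ = 4 * Real.pi * η ^ 2 + η * (Z + 4 * D ^ 2) := by field_simp; ring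
      _ ≤ 4 * Real.pi * η + η * (Z + 4 * D ^ 2) := by gcongr; linarith
      _ ≤ ε := by linarith
  · rw [← localizedExpi_of_abs_le hδ hθ]
    have := abs_le.1 hθ
    exact hasSum_fourierCoeffOn_mul_expi hw.continuous hper hs ⟨by linarith, by linarith⟩

theorem norm_tsum_mul_le {ι : Type*} {c x : ι → ℂ} (hc : Summable fun j => ‖c j‖) {b : ℝ}
    (hx : ∀ j, ‖x j‖ ≤ b) : ‖∑' j, c j * x j‖ ≤ (∑' j, ‖c j‖) * b := by
  rw [← tsum_mul_right]
  refine tsum_of_norm_bounded (hc.mul_right b).hasSum fun j => ?_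
  rw [norm_mul]
  exact mul_le_mul_of_nonneg_left (hx j) (norm_nonneg _)

theorem summable_mul_of_norm_le {ι : Type*} {c x : ι → ℂ} (hc : Summable fun j => ‖c j‖) {b : ℝ}
    (hx : ∀ j, ‖x j‖ ≤ b) : Summable fun j => c j * x j := by
  refine Summable.of_norm_bounded (hc.mul_right b) fun j => ?_
  rw [norm_mul]
  exact mul_le_mul_of_nonneg_left (hx j) (norm_nonneg _)

/-- The coefficient sequence of the difference `x 1 - x 0` of a two-sided sequence `x`. -/
def diffSeq : ℤ → ℂ := Pi.single 1 1 - Pi.single 0 1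

theorem hasSum_diffSeq_mul (x : ℤ → ℂ) : HasSum (fun j => diffSeq j * x j) (x 1 - x 0) := by
  refine ((hasSum_pi_single 1 (x 1)).sub (hasSum_pi_single 0 (x 0))).congr_fun fun j => ?_
  rw [diffSeq, Pi.sub_apply, sub_mul]
  congr 1 <;> by_cases h : j = 1 <;> by_cases h' : j = 0 <;> simp [h, h']

theorem hasSum_norm_diffSeq : HasSum (fun j => ‖diffSeq j‖) 2 := by
  have h : HasSum (fun j => ‖diffSeq j‖) (∑ j ∈ {0, 1}, ‖diffSeq j‖) :=
    hasSum_sum_of_ne_finset_zero fun j hj => by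
      simp only [Finset.mem_insert, Finset.mem_singleton, not_or] at hj
      simp [diffSeq, hj.1, hj.2]
  convert h using 1
  norm_num [diffSeq]

/-- An absolutely summable sequence `c` that is `ε`-close in `ℓ¹` to the difference sequence, and
whose Fourier series vanishes on `[-δ, δ]`. -/
structure IsApproxDiffSeq (c : ℤ → ℂ) (ε δ : ℝ) : Prop where
  summable_norm : Summable fun j => ‖c j‖
  tsum_norm_sub_le : ∑' j, ‖diffSeq j - c j‖ ≤ ε
  tsum_mul_expi_eq_zero : ∀ θ : ℝ, |θ| ≤ δ → ∑' j : ℤ, c j * expi (j * θ) = 0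

namespace IsApproxDiffSeq

variable {c : ℤ → ℂ} {ε δ : ℝ}

theorem summable_norm_sub (hc : IsApproxDiffSeq c ε δ) : Summable fun j => ‖diffSeq j - c j‖ :=
  (hasSum_norm_diffSeq.summable.of_norm.sub hc.summable_norm.of_norm).norm

theorem tsum_norm_le (hc : IsApproxDiffSeq c ε δ) : ∑' j, ‖c j‖ ≤ 2 + ε :=
  calc ∑' j, ‖c j‖ ≤ ∑' j, (‖diffSeq j‖ + ‖diffSeq j - c j‖) :=
        hc.summable_norm.tsum_le_tsum (fun j => by
          simpa only [sub_sub_cancel] using norm_sub_le (diffSeq j) (diffSeq j - c j))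
          (hasSum_norm_diffSeq.summable.add hc.summable_norm_sub)
    _ = 2 + ∑' j, ‖diffSeq j - c j‖ := by
        rw [hasSum_norm_diffSeq.summable.tsum_add hc.summable_norm_sub, hasSum_norm_diffSeq.tsum_eq]
    _ ≤ 2 + ε := by gcongr; exact hc.tsum_norm_sub_le

theorem norm_sub_tsum_le (hc : IsApproxDiffSeq c ε δ) {x : ℤ → ℂ} {b : ℝ} (hx : ∀ j, ‖x j‖ ≤ b) :
    ‖x 1 - x 0 - ∑' j, c j * x j‖ ≤ ε * b := by
  have hcx := summable_mul_of_norm_le hc.summable_norm hx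
  calc ‖x 1 - x 0 - ∑' j, c j * x j‖ = ‖∑' j, (diffSeq j - c j) * x j‖ := by
        rw [← (hasSum_diffSeq_mul x).tsum_eq, ← (hasSum_diffSeq_mul x).summable.tsum_sub hcx]
        simp only [sub_mul]
    _ ≤ (∑' j, ‖diffSeq j - c j‖) * b := norm_tsum_mul_le hc.summable_norm_sub hx
    _ ≤ ε * b :=
        mul_le_mul_of_nonneg_right hc.tsum_norm_sub_le ((norm_nonneg _).trans (hx 0))

end IsApproxDiffSeq

theorem exists_isApproxDiffSeq {ε : ℝ} (hε : 0 < ε) :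
    ∃ δ : ℝ, 0 < δ ∧ ∃ c : ℤ → ℂ, IsApproxDiffSeq c ε δ := by
  obtain ⟨δ, hδ, d, hd, hdε, hdθ⟩ := exists_small_fourierSeries_eq_expi_sub_one hε
  refine ⟨δ, hδ, diffSeq - d, (hasSum_norm_diffSeq.summable.of_norm.sub hd.of_norm).norm, ?_,
    fun θ hθ => ?_⟩
  · simpa only [Pi.sub_apply, sub_sub_cancel] using hdε
  · have h := (hasSum_diffSeq_mul fun j => expi (j * θ)).sub (hdθ θ hθ)
    simp only [Int.cast_one, one_mul, Int.cast_zero, zero_mul, expi_zero, sub_self] at h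
    simpa only [Pi.sub_apply, sub_mul] using h.tsum_eq

/-! ### Winding numbers on a grid -/

theorem abs_arg_lt_pi_div_three {r : ℂ} (hr : ‖r - 1‖ < 3 / 4) :
    |Complex.arg r| < Real.pi / 3 := by
  have hsq : (r.re - 1) ^ 2 + r.im ^ 2 < (3 / 4) ^ 2 := by
    have h := pow_lt_pow_left₀ hr (norm_nonneg _) two_ne_zero
    rw [← Complex.normSq_eq_norm_sq, Complex.normSq_apply] at h
    simp only [Complex.sub_re, Complex.one_re, Complex.sub_im, Complex.one_im, sub_zero] at h
    nlinarith
  have hre : 0 < r.re := by nlinarith [sq_nonneg r.im]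
  have hr0 : r ≠ 0 := fun h => hre.ne' (by rw [h, Complex.zero_re])
  have hnorm : ‖r‖ < 2 * r.re := by
    refine lt_of_pow_lt_pow_left₀ 2 (by positivity) ?_
    rw [← Complex.normSq_eq_norm_sq, Complex.normSq_apply]
    nlinarith [sq_nonneg (r.re - 1 / 4)]
  by_contra! h
  have hcos := Real.cos_le_cos_of_nonneg_of_le_pi (by positivity) (Complex.abs_arg_le_pi r) h
  rw [Real.cos_abs, Complex.cos_arg hr0, Real.cos_pi_div_three,
    div_le_iff₀ (norm_pos_iff.2 hr0)] at hcos
  linarith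

theorem abs_arg_div_lt_pi_div_three {z w : ℂ} (hz : z ≠ 0) (h : ‖w - z‖ < 3 / 4 * ‖z‖) :
    |Complex.arg (w / z)| < Real.pi / 3 := by
  refine abs_arg_lt_pi_div_three ?_
  rwa [div_sub_one hz, norm_div, div_lt_iff₀ (norm_pos_iff.2 hz)]

theorem arg_coe_expi (t : ℝ) :
    (Complex.arg (expi t) : Real.Angle) = ((2 * Real.pi * t : ℝ) : Real.Angle) := by
  rw [expi_eq, Complex.arg_exp_mul_I, Real.Angle.coe_toIocMod]

theorem arg_div_add_arg_div_coe {z w z' w' : ℂ} (hz : z ≠ 0) (hw : w ≠ 0) (hz' : z' ≠ 0)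
    (hw' : w' ≠ 0) :
    ((Complex.arg (w / z) + Complex.arg (w' / w) : ℝ) : Real.Angle)
      = (Complex.arg (z' / z) + Complex.arg (w' / z') : ℝ) := by
  rw [Real.Angle.coe_add, Real.Angle.coe_add,
    ← Complex.arg_mul_coe_angle (div_ne_zero hw hz) (div_ne_zero hw' hw),
    ← Complex.arg_mul_coe_angle (div_ne_zero hz' hz) (div_ne_zero hw' hz')]
  congr 2
  field_simp

theorem eq_of_angle_coe_eq {θ ψ : ℝ} (h : (θ : Real.Angle) = ψ) (hlt : |θ - ψ| < 2 * Real.pi) :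
    θ = ψ := by
  obtain ⟨k, hk⟩ := Real.Angle.angle_eq_iff_two_pi_dvd_sub.1 h
  have hk1 : |(k : ℝ)| < 1 := by
    rw [hk, abs_mul, abs_of_pos Real.two_pi_pos] at hlt
    exact (mul_lt_iff_lt_one_right Real.two_pi_pos).1 hlt
  have hk0 : k = 0 := Int.abs_lt_one_iff.1 (by exact_mod_cast hk1)
  rwa [hk0, Int.cast_zero, mul_zero, sub_eq_zero] at hk

theorem arg_expi_mul_div_expi_mul {z w : ℂ} (hz : z ≠ 0) (hw : w ≠ 0)
    (hlt : |Complex.arg (w / z)| < Real.pi / 3) (s : ℝ) {t : ℝ} (h0 : 0 ≤ t) (h3 : t ≤ 1 / 3) :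
    Complex.arg (expi (s + t) * w / (expi s * z)) = Complex.arg (w / z) + 2 * Real.pi * t := by
  refine eq_of_angle_coe_eq ?_ ?_
  · rw [expi_add, mul_assoc, mul_div_mul_left _ _ (expi_ne_zero _), mul_div_assoc,
      Complex.arg_mul_coe_angle (expi_ne_zero _) (div_ne_zero hw hz), arg_coe_expi, add_comm,
      Real.Angle.coe_add]
  · have h₁ := abs_le.1 (Complex.abs_arg_le_pi (expi (s + t) * w / (expi s * z)))
    have h₂ := abs_lt.1 hlt
    have h₃ : 0 ≤ 2 * Real.pi * t := by positivity
    have h₄ : 2 * Real.pi * t ≤ 2 * Real.pi * (1 / 3) := by gcongr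
    exact abs_lt.2 ⟨by linarith [Real.pi_pos], by linarith [Real.pi_pos]⟩

theorem sum_sub_eq_sum_sub_of_plaquette {G : Type*} [AddCommGroup G] {α β : ℕ → ℕ → G} {N M : ℕ}
    (h : ∀ i < N, ∀ j < M, α i j + β (i + 1) j = β i j + α i (j + 1)) :
    ∑ j ∈ Finset.range M, (β N j - β 0 j) = ∑ i ∈ Finset.range N, (α i M - α i 0) := by
  calc ∑ j ∈ Finset.range M, (β N j - β 0 j)
      = ∑ j ∈ Finset.range M, ∑ i ∈ Finset.range N, (β (i + 1) j - β i j) :=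
        Finset.sum_congr rfl fun j _ => (Finset.sum_range_sub (β · j) N).symm
    _ = ∑ j ∈ Finset.range M, ∑ i ∈ Finset.range N, (α i (j + 1) - α i j) :=
        Finset.sum_congr rfl fun j hj => Finset.sum_congr rfl fun i hi =>
          sub_eq_sub_iff_add_eq_add.2 <| by
            rw [add_comm, h i (Finset.mem_range.1 hi) j (Finset.mem_range.1 hj), add_comm]
    _ = ∑ i ∈ Finset.range N, (α i M - α i 0) := by
        rw [Finset.sum_comm]
        exact Finset.sum_congr rfl fun i _ => Finset.sum_range_sub (α i) M

-- If all increments were small, the arguments of the quotients along the edges would be additive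
-- around each cell, so the winding numbers of `f 0 ·` and `f N ·` would agree; by quasi-periodicity
-- they differ by one.
theorem exists_large_variation {N M : ℕ} (hN : 0 < N) (hM : 3 ≤ M) {f : ℕ → ℕ → ℂ} {y : ℝ}
    (hf : ∀ i j, f i j ≠ 0) (hper : ∀ i, f i M = f i 0)
    (hquasi : ∀ j, f N j = expi (y + j / M) * f 0 j) :
    ∃ i < N, ∃ j < M, 3 / 4 * ‖f i j‖ ≤ ‖f (i + 1) j - f i j‖ ∨
      3 / 4 * ‖f i j‖ ≤ ‖f i (j + 1) - f i j‖ := by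
  by_contra! hcon
  have hM3 : (3 : ℝ) ≤ M := by exact_mod_cast hM
  let α (i j : ℕ) : ℝ := Complex.arg (f (i + 1) j / f i j)
  let β (i j : ℕ) : ℝ := Complex.arg (f i (j + 1) / f i j)
  have hαper (i : ℕ) : α i M = α i 0 := by simp only [α, hper]
  have hα (i : ℕ) (hi : i < N) (j : ℕ) (hj : j ≤ M) : |α i j| < Real.pi / 3 := by
    rcases hj.lt_or_eq with h | rfl
    · exact abs_arg_div_lt_pi_div_three (hf i j) (hcon i hi j h).1
    · rw [hαper]
      exact abs_arg_div_lt_pi_div_three (hf i 0) (hcon i hi 0 (by omega)).1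
  have hβ (i : ℕ) (hi : i < N) (j : ℕ) (hj : j < M) : |β i j| < Real.pi / 3 :=
    abs_arg_div_lt_pi_div_three (hf i j) (hcon i hi j hj).2
  have hplaquette (i : ℕ) (hi : i < N) (j : ℕ) (hj : j < M) :
      α i j + β (i + 1) j = β i j + α i (j + 1) := by
    refine eq_of_angle_coe_eq (arg_div_add_arg_div_coe (hf _ _) (hf _ _) (hf _ _) (hf _ _)) ?_
    have h₁ := abs_lt.1 (hα i hi j hj.le)
    have h₂ := abs_lt.1 (hα i hi (j + 1) hj)
    have h₃ := abs_lt.1 (hβ i hi j hj)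
    have h₄ := abs_le.1 (Complex.abs_arg_le_pi (f (i + 1) (j + 1) / f (i + 1) j))
    exact abs_lt.2 ⟨by linarith [Real.pi_pos], by linarith [Real.pi_pos]⟩
  have hjump (j : ℕ) (hj : j < M) : β N j - β 0 j = 2 * Real.pi * (1 / M) := by
    simp only [β]
    rw [hquasi, hquasi, show y + (j + 1 : ℕ) / M = y + j / M + 1 / M by push_cast; ring,
      arg_expi_mul_div_expi_mul (hf _ _) (hf _ _) (hβ 0 hN j hj) _ (by positivity) (by gcongr),
      add_sub_cancel_left]
  have hwinding : 2 * Real.pi = 0 :=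
    calc 2 * Real.pi = ∑ _j ∈ Finset.range M, 2 * Real.pi * (1 / M) := by
          rw [Finset.sum_const, Finset.card_range, nsmul_eq_mul]
          field_simp
      _ = ∑ j ∈ Finset.range M, (β N j - β 0 j) :=
          Finset.sum_congr rfl fun j hj => (hjump j (Finset.mem_range.1 hj)).symm
      _ = ∑ i ∈ Finset.range N, (α i M - α i 0) := sum_sub_eq_sum_sub_of_plaquette hplaquette
      _ = 0 := Finset.sum_eq_zero fun i _ => sub_eq_zero.2 (hαper i)
  exact Real.two_pi_pos.ne' hwinding

theorem measure_le_of_exists_add_mem {G ι : Type*} [AddGroup G] [MeasurableSpace G]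
    [MeasurableAdd G] {μ : Measure G} [μ.IsAddRightInvariant] {I : Finset ι} {v : ι → G}
    {S T : Set G} (hS : MeasurableSet S) (hT : MeasurableSet T)
    (hdisj : Pairwise (Function.onFun Disjoint fun q => (· + v q) '' T))
    (h : ∀ p ∈ T, ∃ q ∈ I, p + v q ∈ S) :
    μ T ≤ μ (S ∩ ⋃ q ∈ I, (· + v q) '' T) := by
  have hmeas (q : ι) : MeasurableSet (S ∩ (· + v q) '' T) := by
    refine hS.inter ?_
    rw [image_add_right]
    exact measurable_add_const _ hT
  have hcover : T ⊆ ⋃ q ∈ I, (· + v q) ⁻¹' (S ∩ (· + v q) '' T) := fun p hp => by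
    obtain ⟨q, hq, hpq⟩ := h p hp
    exact mem_biUnion hq ⟨hpq, p, hp, rfl⟩
  calc μ T ≤ ∑ q ∈ I, μ ((· + v q) ⁻¹' (S ∩ (· + v q) '' T)) :=
        (measure_mono hcover).trans (measure_biUnion_finset_le _ _)
    _ = ∑ q ∈ I, μ (S ∩ (· + v q) '' T) :=
        Finset.sum_congr rfl fun q _ => measure_preimage_add_right μ (v q) _
    _ = μ (⋃ q ∈ I, S ∩ (· + v q) '' T) :=
        (measure_biUnion_finset
          (fun q _ q' _ hne => (hdisj hne).mono inter_subset_right inter_subset_right)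
          fun q _ => hmeas q).symm
    _ = μ (S ∩ ⋃ q ∈ I, (· + v q) '' T) := by rw [inter_iUnion₂]

section GridCell

variable {N : ℕ} {x : ℝ}

theorem floor_add_div_mul_of_mem_Ico (hN : 0 < N) (hx : x ∈ Ico 0 (1 / (N : ℝ))) (i : ℕ) :
    ⌊(x + i / N) * N⌋₊ = i := by
  have hN0 : (0 : ℝ) < N := Nat.cast_pos.2 hN
  rw [add_mul, div_mul_cancel₀ _ hN0.ne', Nat.floor_add_natCast (mul_nonneg hx.1 hN0.le),
    Nat.floor_eq_zero.2 ((lt_div_iff₀ hN0).1 hx.2), zero_add]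

theorem add_div_mem_Ico_zero_one (hN : 0 < N) (hx : x ∈ Ico 0 (1 / (N : ℝ))) {i : ℕ}
    (hi : i < N) : x + i / N ∈ Ico (0 : ℝ) 1 := by
  have hN0 : (0 : ℝ) < N := Nat.cast_pos.2 hN
  refine ⟨add_nonneg hx.1 (by positivity), ?_⟩
  calc x + i / N < 1 / N + i / N := by linarith [hx.2]
    _ = (i + 1 : ℕ) / N := by push_cast; ring
    _ ≤ 1 := div_le_one_of_le₀ (Nat.cast_le.2 hi) hN0.le

end GridCell

theorem one_le_mul_measure_of_grid {N M : ℕ} (hN : 0 < N) (hM : 0 < M) {S : Set (ℝ × ℝ)}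
    (hS : MeasurableSet S)
    (h : ∀ x ∈ Ico 0 (1 / (N : ℝ)), ∀ y ∈ Ico 0 (1 / (M : ℝ)),
      ∃ i < N, ∃ j < M, (x + i / N, y + j / M) ∈ S) :
    1 ≤ (N * M : ℝ≥0∞) * squareMeasure S := by
  set T : Set (ℝ × ℝ) := Ico 0 (1 / (N : ℝ)) ×ˢ Ico 0 (1 / (M : ℝ))
  let v (q : ℕ × ℕ) : ℝ × ℝ := (q.1 / N, q.2 / M)
  let I := Finset.range N ×ˢ Finset.range M
  have hvolT : (N * M : ℝ≥0∞) * volume T = 1 := by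
    rw [Measure.volume_eq_prod, Measure.prod_prod, Real.volume_Ico, Real.volume_Ico, sub_zero,
      sub_zero, ← ENNReal.ofReal_natCast N, ← ENNReal.ofReal_natCast M,
      mul_mul_mul_comm, ← ENNReal.ofReal_mul (by positivity), ← ENNReal.ofReal_mul (by positivity),
      mul_one_div_cancel (by positivity), mul_one_div_cancel (by positivity), ENNReal.ofReal_one,
      one_mul]
  have hdisj : Pairwise (Function.onFun Disjoint fun q => (· + v q) '' T) := fun q q' hne => by
    refine Set.disjoint_left.2 ?_
    rintro _ ⟨p, hp, rfl⟩ ⟨p', hp', hpp'⟩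
    rw [Prod.ext_iff] at hpp'
    refine hne (Prod.ext ?_ ?_)
    · rw [← floor_add_div_mul_of_mem_Ico hN hp.1 q.1, ← floor_add_div_mul_of_mem_Ico hN hp'.1 q'.1]
      exact congrArg (⌊· * (N : ℝ)⌋₊) hpp'.1.symm
    · rw [← floor_add_div_mul_of_mem_Ico hM hp.2 q.2, ← floor_add_div_mul_of_mem_Ico hM hp'.2 q'.2]
      exact congrArg (⌊· * (M : ℝ)⌋₊) hpp'.2.symm
  have hsub : ⋃ q ∈ I, (· + v q) '' T ⊆ Ico 0 1 ×ˢ Ico 0 1 := by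
    refine iUnion₂_subset fun q hq => image_subset_iff.2 fun p hp => ?_
    obtain ⟨hi, hj⟩ := Finset.mem_product.1 hq
    exact ⟨add_div_mem_Ico_zero_one hN hp.1 (Finset.mem_range.1 hi),
      add_div_mem_Ico_zero_one hM hp.2 (Finset.mem_range.1 hj)⟩
  calc 1 = (N * M : ℝ≥0∞) * volume T := hvolT.symm
    _ ≤ (N * M : ℝ≥0∞) * volume (S ∩ ⋃ q ∈ I, (· + v q) '' T) := by
        refine mul_le_mul_right ?_ _
        refine measure_le_of_exists_add_mem hS (measurableSet_Ico.prod measurableSet_Ico) hdisj ?_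
        rintro ⟨x, y⟩ ⟨hx, hy⟩
        obtain ⟨i, hi, j, hj, hmem⟩ := h x hx y hy
        exact ⟨(i, j), Finset.mk_mem_product (Finset.mem_range.2 hi) (Finset.mem_range.2 hj), hmem⟩
    _ ≤ (N * M : ℝ≥0∞) * squareMeasure S := by
        rw [squareMeasure_eq_restrict, Measure.restrict_apply hS]
        gcongr

/-! ### Quasi-periodic functions -/

/-- The functional equations of a Zak transform `F (x, y)`: it is `1`-periodic in `y`, and moving
`x` by `1` multiplies it by `expi y`. -/
structure IsQuasiPeriodic (F : ℝ × ℝ → ℂ) : Prop where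
  add_one_fst : ∀ x y, F (x + 1, y) = expi y * F (x, y)
  add_one_snd : ∀ x y, F (x, y + 1) = F (x, y)

namespace IsQuasiPeriodic

variable {F : ℝ × ℝ → ℂ}

theorem add_intCast_fst (hF : IsQuasiPeriodic F) (x y : ℝ) (n : ℤ) :
    F (x + n, y) = expi (n * y) * F (x, y) := by
  have hper : Function.Periodic (fun x => expi (-(x * y)) * F (x, y)) 1 := fun x => by
    simp only [hF.add_one_fst, ← mul_assoc, ← expi_add]
    ring_nf
  have h := hper.int_mul n x
  simp only [mul_one] at h
  calc F (x + n, y) = expi ((x + n) * y) * (expi (-((x + n) * y)) * F (x + n, y)) := by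
        rw [← mul_assoc, ← expi_add, add_neg_cancel, expi_zero, one_mul]
    _ = expi (n * y) * F (x, y) := by
        rw [h, ← mul_assoc, ← expi_add]
        ring_nf

theorem eq_fract (hF : IsQuasiPeriodic F) (x y : ℝ) :
    F (x, y) = expi (⌊x⌋ * y) * F (Int.fract x, y) := by
  rw [← hF.add_intCast_fst, Int.fract_add_floor]

theorem zakInv_eq (hF : IsQuasiPeriodic F) (t : ℝ) :
    zakInv F t = ∫ y, F (t, y) ∂unitMeasure := by
  simp only [zakInv, ← hF.eq_fract]

theorem integral_add_snd (hF : IsQuasiPeriodic F) (t s : ℝ) :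
    ∫ y, F (t, y + s) ∂unitMeasure = ∫ y, F (t, y) ∂unitMeasure := by
  have hper : Function.Periodic (fun y => F (t, y)) 1 := hF.add_one_snd t
  rw [integral_unitMeasure, integral_unitMeasure,
    intervalIntegral.integral_comp_add_right (fun y => F (t, y)) s, zero_add, add_comm 1 s,
    hper.intervalIntegral_add_eq s 0, zero_add]

theorem comp_add_fst (hF : IsQuasiPeriodic F) (s : ℝ) :
    IsQuasiPeriodic fun z => F (z.1 + s, z.2) where
  add_one_fst x y := by rw [add_right_comm, hF.add_one_fst]
  add_one_snd x y := hF.add_one_snd _ _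

theorem modulate (hF : IsQuasiPeriodic F) (s : ℝ) :
    IsQuasiPeriodic fun z => expi (-(s * z.1)) * F (z.1, z.2 + s) where
  add_one_fst x y := by
    rw [hF.add_one_fst, ← mul_assoc, ← mul_assoc, ← expi_add, ← expi_add]
    ring_nf
  add_one_snd x y := by rw [add_right_comm, hF.add_one_snd]

theorem tsum {ι : Type*} {Φ : ι → ℝ × ℝ → ℂ} (hΦ : ∀ j, IsQuasiPeriodic (Φ j)) (c : ι → ℂ) :
    IsQuasiPeriodic fun z => ∑' j, c j * Φ j z where
  add_one_fst x y := by
    simp only [(hΦ _).add_one_fst, mul_left_comm _ (expi y), tsum_mul_left]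
  add_one_snd x y := by simp only [(hΦ _).add_one_snd]

theorem zakInv_comp_add_fst (hF : IsQuasiPeriodic F) (s t : ℝ) :
    zakInv (fun z => F (z.1 + s, z.2)) t = zakInv F (t + s) := by
  rw [(hF.comp_add_fst s).zakInv_eq, hF.zakInv_eq]

theorem zakInv_modulate (hF : IsQuasiPeriodic F) (s t : ℝ) :
    zakInv (fun z => expi (-(s * z.1)) * F (z.1, z.2 + s)) t = expi (-(s * t)) * zakInv F t := by
  rw [(hF.modulate s).zakInv_eq, hF.zakInv_eq, ← hF.integral_add_snd t s]
  exact integral_const_mul (L := ℂ) (expi (-(s * t))) fun y => F (t, y + s)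

theorem norm_zakInv_le (hF : IsQuasiPeriodic F) {b : ℝ} (hb : ∀ z, ‖F z‖ ≤ b) (t : ℝ) :
    ‖zakInv F t‖ ≤ b := by
  rw [hF.zakInv_eq]
  refine (norm_integral_le_of_norm_le_const (ae_of_all _ fun y => hb (t, y))).trans_eq ?_
  rw [probReal_univ, mul_one]

end IsQuasiPeriodic

section Combinations

variable {ι : Type*} [Countable ι] {b : ℝ} {c : ι → ℂ}

theorem stronglyMeasurable_tsum_const_mul {α : Type*} [MeasurableSpace α] {Φ : ι → α → ℂ}
    (hΦ : ∀ j, StronglyMeasurable (Φ j)) (hb : ∀ j z, ‖Φ j z‖ ≤ b)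
    (hc : Summable fun j => ‖c j‖) : StronglyMeasurable fun z => ∑' j, c j * Φ j z :=
  stronglyMeasurable_of_tendsto (atTop : Filter (Finset ι))
    (f := fun S z => ∑ j ∈ S, c j * Φ j z)
    (fun S => Finset.stronglyMeasurable_fun_sum S fun j _ => (hΦ j).const_mul (c j))
    (tendsto_pi_nhds.2 fun z => (summable_mul_of_norm_le hc fun j => hb j z).hasSum)

variable {Φ : ι → ℝ × ℝ → ℂ}

theorem zakInv_tsum (hq : ∀ j, IsQuasiPeriodic (Φ j)) (hΦ : ∀ j, StronglyMeasurable (Φ j))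
    (hb : ∀ j z, ‖Φ j z‖ ≤ b) (hc : Summable fun j => ‖c j‖) (t : ℝ) :
    zakInv (fun z => ∑' j, c j * Φ j z) t = ∑' j, c j * zakInv (Φ j) t := by
  simp only [(IsQuasiPeriodic.tsum hq c).zakInv_eq, (hq _).zakInv_eq, ← integral_const_mul]
  have hnorm (j : ι) (y : ℝ) : ‖c j * Φ j (t, y)‖ ≤ ‖c j‖ * b := by
    rw [norm_mul]
    exact mul_le_mul_of_nonneg_left (hb j _) (norm_nonneg _)
  have hint (j : ι) : Integrable (fun y => c j * Φ j (t, y)) unitMeasure :=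
    Integrable.of_bound (((hΦ j).comp_measurable measurable_prodMk_left).const_mul
      (c j)).aestronglyMeasurable (‖c j‖ * b) (ae_of_all _ (hnorm j))
  refine (integral_tsum_of_summable_integral_norm hint ?_).symm
  refine (hc.mul_right b).of_nonneg_of_le (fun j => integral_nonneg fun y => norm_nonneg _)
    fun j => ?_
  calc ∫ y, ‖c j * Φ j (t, y)‖ ∂unitMeasure ≤ ∫ _, ‖c j‖ * b ∂unitMeasure :=
        integral_mono (hint j).norm (integrable_const _) (hnorm j)
    _ = ‖c j‖ * b := by rw [integral_const, probReal_univ, one_smul]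

theorem lintegral_enorm_tsum_sq (hq : ∀ j, IsQuasiPeriodic (Φ j))
    (hΦ : ∀ j, StronglyMeasurable (Φ j)) (hb : ∀ j z, ‖Φ j z‖ ≤ b)
    (hc : Summable fun j => ‖c j‖) :
    ∫⁻ z, ‖∑' j, c j * Φ j z‖ₑ ^ 2 ∂squareMeasure
      = ∫⁻ t, ‖∑' j, c j * zakInv (Φ j) t‖ₑ ^ 2 := by
  have hmeas := stronglyMeasurable_tsum_const_mul hΦ hb hc
  rw [← lintegral_zakInv hmeas (MemLp.of_bound hmeas.aestronglyMeasurable _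
    (ae_of_all _ fun z => norm_tsum_mul_le hc fun j => hb j z))]
  simp only [zakInv_tsum hq hΦ hb hc]

variable {F : ℝ × ℝ → ℂ}

theorem lintegral_tsum_comp_add_fst (hq : IsQuasiPeriodic F) (hF : StronglyMeasurable F)
    (hb : ∀ z, ‖F z‖ ≤ b) (hc : Summable fun j => ‖c j‖) (hg : MemLp (zakInv F) 2 volume)
    (s : ι → ℝ) :
    ∫⁻ z, ‖∑' j, c j * F (z.1 + s j, z.2)‖ₑ ^ 2 ∂squareMeasure
      = ∫⁻ ξ, ‖∑' j, c j * expi (s j * ξ)‖ₑ ^ 2 * ‖(𝓕 (hg.toLp (zakInv F)) : L2R) ξ‖ₑ ^ 2 := by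
  rw [lintegral_enorm_tsum_sq (fun j => hq.comp_add_fst (s j))
    (fun j => hF.comp_measurable (by fun_prop)) (fun j z => hb _) hc]
  simp only [hq.zakInv_comp_add_fst]
  exact lintegral_tsum_translate hg (hq.norm_zakInv_le hb) hc s

theorem lintegral_tsum_modulate (hq : IsQuasiPeriodic F) (hF : StronglyMeasurable F)
    (hb : ∀ z, ‖F z‖ ≤ b) (hc : Summable fun j => ‖c j‖) (s : ι → ℝ) :
    ∫⁻ z, ‖∑' j, c j * (expi (-(s j * z.1)) * F (z.1, z.2 + s j))‖ₑ ^ 2 ∂squareMeasure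
      = ∫⁻ t, ‖∑' j, c j * expi (-(s j * t))‖ₑ ^ 2 * ‖zakInv F t‖ₑ ^ 2 := by
  have hmeas (j : ι) : StronglyMeasurable
      fun z : ℝ × ℝ => expi (-(s j * z.1)) * F (z.1, z.2 + s j) :=
    (Measurable.stronglyMeasurable (by fun_prop)).mul (hF.comp_measurable (by fun_prop))
  have hbound (j : ι) (z : ℝ × ℝ) : ‖expi (-(s j * z.1)) * F (z.1, z.2 + s j)‖ ≤ b := by
    rw [norm_mul, norm_expi, one_mul]
    exact hb _
  rw [lintegral_enorm_tsum_sq (fun j => hq.modulate (s j)) hmeas hbound hc]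
  simp only [hq.zakInv_modulate, ← mul_assoc, tsum_mul_right, enorm_mul, mul_pow]

end Combinations

/-- The quasi-periodic extension of a function on `[0, 1)²`. -/
noncomputable def quasiExtend (f : ℝ × ℝ → ℂ) (z : ℝ × ℝ) : ℂ :=
  expi (⌊z.1⌋ * z.2) * f (Int.fract z.1, Int.fract z.2)

theorem isQuasiPeriodic_quasiExtend (f : ℝ × ℝ → ℂ) : IsQuasiPeriodic (quasiExtend f) where
  add_one_fst x y := by
    simp only [quasiExtend, Int.floor_add_one, Int.fract_add_one, ← mul_assoc, ← expi_add]
    push_cast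
    ring_nf
  add_one_snd x y := by
    rw [quasiExtend, quasiExtend, Int.fract_add_one, mul_add, mul_one, expi_add_intCast]

theorem quasiExtend_of_mem (f : ℝ × ℝ → ℂ) {z : ℝ × ℝ} (h₁ : z.1 ∈ Ico (0 : ℝ) 1)
    (h₂ : z.2 ∈ Ico (0 : ℝ) 1) : quasiExtend f z = f z := by
  rw [quasiExtend, Int.floor_eq_zero_iff.2 h₁, Int.fract_eq_self.2 h₁, Int.fract_eq_self.2 h₂,
    Int.cast_zero, zero_mul, expi_zero, one_mul]

theorem stronglyMeasurable_quasiExtend {f : ℝ × ℝ → ℂ} (hf : StronglyMeasurable f) :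
    StronglyMeasurable (quasiExtend f) := by
  have hfloor : Measurable fun z : ℝ × ℝ => (⌊z.1⌋ : ℝ) :=
    measurable_from_top.comp (Int.measurable_floor.comp measurable_fst)
  exact (Measurable.stronglyMeasurable (by fun_prop)).mul (hf.comp_measurable (by fun_prop))

theorem norm_quasiExtend (f : ℝ × ℝ → ℂ) (z : ℝ × ℝ) :
    ‖quasiExtend f z‖ = ‖f (Int.fract z.1, Int.fract z.2)‖ := by
  rw [quasiExtend, norm_mul, norm_expi, one_mul]

theorem exists_isQuasiPeriodic_ae_eq {f : ℝ × ℝ → ℂ} (hf : StronglyMeasurable f) {a b : ℝ}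
    (ha : 0 ≤ a) (h : ∀ᵐ z ∂squareMeasure, a ≤ ‖f z‖ ∧ ‖f z‖ ≤ b) :
    ∃ F : ℝ × ℝ → ℂ, IsQuasiPeriodic F ∧ StronglyMeasurable F ∧
      (∀ z, a ≤ ‖F z‖ ∧ ‖F z‖ ≤ b) ∧ f =ᵐ[squareMeasure] F := by
  classical
  have hab : a ≤ b := by
    obtain ⟨z, hz⟩ := h.exists
    exact hz.1.trans hz.2
  let E : Set (ℝ × ℝ) := {z | a ≤ ‖f z‖ ∧ ‖f z‖ ≤ b}
  have hE : MeasurableSet E :=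
    (measurableSet_le measurable_const hf.norm.measurable).inter
      (measurableSet_le hf.norm.measurable measurable_const)
  let f' : ℝ × ℝ → ℂ := E.piecewise f fun _ => a
  have hf' : StronglyMeasurable f' := hf.piecewise hE stronglyMeasurable_const
  have hbound (z : ℝ × ℝ) : a ≤ ‖f' z‖ ∧ ‖f' z‖ ≤ b := by
    by_cases hz : z ∈ E
    · simpa only [f', piecewise_eq_of_mem _ _ _ hz] using show a ≤ ‖f z‖ ∧ ‖f z‖ ≤ b from hz
    · simp only [f', piecewise_eq_of_notMem _ _ _ hz, Complex.norm_of_nonneg ha]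
      exact ⟨le_rfl, hab⟩
  refine ⟨quasiExtend f', isQuasiPeriodic_quasiExtend f', stronglyMeasurable_quasiExtend hf',
    fun z => ?_, ?_⟩
  · rw [norm_quasiExtend]
    exact hbound _
  · filter_upwards [h, ae_squareMeasure_mem] with z hz hmem
    rw [quasiExtend_of_mem f' hmem.1 hmem.2]
    exact (piecewise_eq_of_mem E _ _ hz).symm

/-! ### The lower bound -/

theorem measurableSet_le_abs (R : ℝ) : MeasurableSet {t : ℝ | R ≤ |t|} :=
  measurableSet_le measurable_const measurable_norm

theorem timeFreqTail_nonneg (g : L2R) (R L : ℝ) : 0 ≤ timeFreqTail g R L :=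
  add_nonneg (integral_nonneg fun _ => by positivity) (integral_nonneg fun _ => by positivity)

theorem ofReal_timeFreqTail (g : L2R) (R L : ℝ) :
    ENNReal.ofReal (timeFreqTail g R L) = (∫⁻ t in {t : ℝ | R ≤ |t|}, ‖g t‖ₑ ^ 2)
      + ∫⁻ ξ in {ξ : ℝ | L ≤ |ξ|}, ‖(𝓕 g : L2R) ξ‖ₑ ^ 2 := by
  rw [lintegral_enorm_sq_eq_ofReal ((Lp.memLp g).restrict _),
    lintegral_enorm_sq_eq_ofReal ((Lp.memLp (𝓕 g : L2R)).restrict _), timeFreqTail,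
    ENNReal.ofReal_add (integral_nonneg fun _ => by positivity)
      (integral_nonneg fun _ => by positivity)]

theorem ofReal_timeFreqTail_toLp {g : ℝ → ℂ} (hg : MemLp g 2 volume) (R L : ℝ) :
    ENNReal.ofReal (timeFreqTail (hg.toLp g) R L) = (∫⁻ t in {t : ℝ | R ≤ |t|}, ‖g t‖ₑ ^ 2)
      + ∫⁻ ξ in {ξ : ℝ | L ≤ |ξ|}, ‖(𝓕 (hg.toLp g) : L2R) ξ‖ₑ ^ 2 := by
  rw [ofReal_timeFreqTail]
  congr 1
  refine lintegral_congr_ae (ae_restrict_of_ae ?_)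
  filter_upwards [hg.coeFn_toLp] with t ht
  rw [ht]

section MeasureSpace

variable {α : Type*} [MeasurableSpace α] {μ : Measure α}

theorem lintegral_enorm_sq_mul_le_setLIntegral {S : Set α} (hS : MeasurableSet S) {w : α → ℂ}
    {K : ℝ} (hw : ∀ x, ‖w x‖ ≤ K) (h0 : ∀ x ∉ S, w x = 0) (k : α → ℝ≥0∞) :
    ∫⁻ x, ‖w x‖ₑ ^ 2 * k x ∂μ ≤ ENNReal.ofReal (K ^ 2) * ∫⁻ x in S, k x ∂μ := by
  rw [← lintegral_const_mul' _ _ ENNReal.ofReal_ne_top, ← lintegral_indicator hS]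
  refine lintegral_mono fun x => ?_
  by_cases hx : x ∈ S
  · rw [indicator_of_mem hx, ← ofReal_norm, ← ENNReal.ofReal_pow (norm_nonneg _)]
    gcongr
    exact hw x
  · simp [h0 x hx]

theorem ofReal_sq_mul_measure_le_of_norm_sub_le {D U : α → ℂ} (hU : AEStronglyMeasurable U μ)
    {r s : ℝ} (hr : 0 ≤ r) (hDU : ∀ z, ‖D z - U z‖ ≤ s) :
    ENNReal.ofReal (r ^ 2) * μ {z | r + s ≤ ‖D z‖} ≤ ∫⁻ z, ‖U z‖ₑ ^ 2 ∂μ := by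
  refine le_trans ?_ (mul_meas_ge_le_lintegral₀ (hU.enorm.pow_const 2) (ENNReal.ofReal (r ^ 2)))
  gcongr with z
  intro hz
  have hrU : r ≤ ‖U z‖ := by linarith [norm_sub_norm_le (D z) (U z), hDU z]
  rw [← ofReal_norm, ← ENNReal.ofReal_pow (norm_nonneg _)]
  exact ENNReal.ofReal_le_ofReal (pow_le_pow_left₀ hr hrU 2)

end MeasureSpace

section Variation

variable {F : ℝ × ℝ → ℂ} {b r h ε δ : ℝ} {c : ℤ → ℂ}

theorem IsApproxDiffSeq.measure_variation_le (hc : IsApproxDiffSeq c ε δ) {Φ : ℤ → ℝ × ℝ → ℂ}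
    (hΦ : ∀ j, StronglyMeasurable (Φ j)) (hb : ∀ j z, ‖Φ j z‖ ≤ b) (hr : 0 ≤ r) :
    ENNReal.ofReal (r ^ 2) * squareMeasure {z | r + ε * b ≤ ‖Φ 1 z - Φ 0 z‖}
      ≤ ∫⁻ z, ‖∑' j, c j * Φ j z‖ₑ ^ 2 ∂squareMeasure :=
  ofReal_sq_mul_measure_le_of_norm_sub_le
    (stronglyMeasurable_tsum_const_mul hΦ hb hc.summable_norm).aestronglyMeasurable hr
    fun z => hc.norm_sub_tsum_le fun j => hb j z

theorem IsApproxDiffSeq.lintegral_mul_le_tail (hc : IsApproxDiffSeq c ε δ) {L : ℝ}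
    (hh : |h| * L ≤ δ) (k : ℝ → ℝ≥0∞) :
    ∫⁻ ξ, ‖∑' j : ℤ, c j * expi (j * (h * ξ))‖ₑ ^ 2 * k ξ
      ≤ ENNReal.ofReal ((2 + ε) ^ 2) * ∫⁻ ξ in {ξ : ℝ | L ≤ |ξ|}, k ξ := by
  refine lintegral_enorm_sq_mul_le_setLIntegral (measurableSet_le_abs L) (fun ξ => ?_)
    (fun ξ hξ => ?_) k
  · refine (norm_tsum_mul_le hc.summable_norm fun j => (norm_expi _).le).trans ?_
    rw [mul_one]
    exact hc.tsum_norm_le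
  · have hξL : |ξ| ≤ L := (not_le.1 hξ).le
    refine hc.tsum_mul_expi_eq_zero _ ?_
    rw [abs_mul]
    exact (mul_le_mul_of_nonneg_left hξL (abs_nonneg h)).trans hh

theorem IsQuasiPeriodic.measure_variation_fst_le (hq : IsQuasiPeriodic F)
    (hF : StronglyMeasurable F) (hb : ∀ z, ‖F z‖ ≤ b) (hg : MemLp (zakInv F) 2 volume)
    (hc : IsApproxDiffSeq c ε δ) (hr : 0 ≤ r) {L : ℝ} (hh : |h| * L ≤ δ) :
    ENNReal.ofReal (r ^ 2) * squareMeasure {z | r + ε * b ≤ ‖F (z.1 + h, z.2) - F z‖}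
      ≤ ENNReal.ofReal ((2 + ε) ^ 2) *
        ∫⁻ ξ in {ξ : ℝ | L ≤ |ξ|}, ‖(𝓕 (hg.toLp (zakInv F)) : L2R) ξ‖ₑ ^ 2 := by
  have hvar := hc.measure_variation_le (Φ := fun j z => F (z.1 + j * h, z.2))
    (fun j => hF.comp_measurable (by fun_prop)) (fun j z => hb _) hr
  rw [lintegral_tsum_comp_add_fst hq hF hb hc.summable_norm hg] at hvar
  simp only [Int.cast_one, one_mul, Int.cast_zero, zero_mul, add_zero, mul_assoc] at hvar
  exact hvar.trans (hc.lintegral_mul_le_tail hh _)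

theorem IsQuasiPeriodic.measure_variation_snd_le (hq : IsQuasiPeriodic F)
    (hF : StronglyMeasurable F) (hb : ∀ z, ‖F z‖ ≤ b) (hc : IsApproxDiffSeq c ε δ) (hr : 0 ≤ r)
    {R : ℝ} (hh : |h| * R ≤ δ) :
    ENNReal.ofReal (r ^ 2) *
        squareMeasure {z | r + ε * b ≤ ‖expi (-(h * z.1)) * F (z.1, z.2 + h) - F z‖}
      ≤ ENNReal.ofReal ((2 + ε) ^ 2) * ∫⁻ t in {t : ℝ | R ≤ |t|}, ‖zakInv F t‖ₑ ^ 2 := by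
  have hvar := hc.measure_variation_le
    (Φ := fun j z => expi (-(j * h * z.1)) * F (z.1, z.2 + j * h))
    (fun j => (Measurable.stronglyMeasurable (by fun_prop)).mul
      (hF.comp_measurable (by fun_prop)))
    (fun j z => by rw [norm_mul, norm_expi, one_mul]; exact hb _) hr
  have harg (j : ℤ) (t : ℝ) : -(j * h * t) = j * (-h * t) := by ring
  rw [lintegral_tsum_modulate hq hF hb hc.summable_norm] at hvar
  simp only [Int.cast_one, Int.cast_zero, zero_mul, add_zero, neg_zero, expi_zero, one_mul, harg]
    at hvar
  exact hvar.trans (hc.lintegral_mul_le_tail (by rwa [abs_neg]) _)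

end Variation

theorem norm_sub_le_norm_expi_mul_sub_add (s : ℝ) (w z : ℂ) :
    ‖w - z‖ ≤ ‖expi s * w - z‖ + 2 * Real.pi * |s| * ‖w‖ := by
  calc ‖w - z‖ = ‖expi s * w - z - (expi s - 1) * w‖ := by ring_nf
    _ ≤ ‖expi s * w - z‖ + ‖expi s - 1‖ * ‖w‖ := (norm_sub_le _ _).trans_eq (by rw [norm_mul])
    _ ≤ ‖expi s * w - z‖ + 2 * Real.pi * |s| * ‖w‖ := by
        gcongr
        exact norm_expi_sub_one_le s

section LowerBound

variable {F : ℝ × ℝ → ℂ} {a b : ℝ}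

theorem half_le_norm_expi_mul_sub {w z : ℂ} {s : ℝ} (hz : a ≤ ‖z‖) (hw : ‖w‖ ≤ b)
    (hs : 8 * Real.pi * b * |s| ≤ a) (hwz : 3 / 4 * ‖z‖ ≤ ‖w - z‖) :
    a / 2 ≤ ‖expi s * w - z‖ := by
  have hsw : 2 * Real.pi * |s| * ‖w‖ ≤ 2 * Real.pi * |s| * b := by gcongr
  linarith [norm_sub_le_norm_expi_mul_sub_add s w z]

theorem IsQuasiPeriodic.exists_large_variation (hq : IsQuasiPeriodic F) (ha : 0 < a)
    (hF : ∀ z, a ≤ ‖F z‖ ∧ ‖F z‖ ≤ b) {N M : ℕ} (hN : 0 < N) (hM : 3 ≤ M)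
    (hMb : 8 * Real.pi * b ≤ a * M) {x : ℝ} (hx : x ∈ Ico 0 (1 / (N : ℝ))) (y : ℝ) :
    ∃ i < N, ∃ j < M, (x + i / N, y + j / M) ∈
      {z | a / 2 ≤ ‖F (z.1 + 1 / N, z.2) - F z‖}
        ∪ {z | a / 2 ≤ ‖expi (-(1 / M * z.1)) * F (z.1, z.2 + 1 / M) - F z‖} := by
  have hN0 : (N : ℝ) ≠ 0 := by positivity
  have hM0 : (0 : ℝ) < M := by positivity
  obtain ⟨i, hi, j, hj, hij⟩ := _root_.exists_large_variation (N := N) (M := M) (y := y)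
    (f := fun i j => F (x + i / N, y + j / M)) hN hM
    (fun i j => norm_pos_iff.1 (ha.trans_le (hF _).1))
    (fun i => by simp only [div_self hM0.ne', Nat.cast_zero, zero_div, add_zero, hq.add_one_snd])
    (fun j => by simp only [div_self hN0, Nat.cast_zero, zero_div, add_zero, hq.add_one_fst])
  have hz := (hF (x + i / N, y + j / M)).1
  refine ⟨i, hi, j, hj, hij.imp (fun hfst => ?_) fun hsnd => ?_⟩
  · rw [Nat.cast_add_one, add_div, ← add_assoc] at hfst
    rw [mem_ofPred_eq]
    linarith
  · rw [Nat.cast_add_one, add_div, ← add_assoc] at hsnd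
    refine half_le_norm_expi_mul_sub hz (hF _).2 ?_ hsnd
    obtain ⟨hx0, hx1⟩ := add_div_mem_Ico_zero_one hN hx hi
    have hb : 0 ≤ b := (norm_nonneg _).trans (hF 0).2
    rw [abs_neg, abs_of_nonneg (by positivity)]
    calc 8 * Real.pi * b * (1 / M * (x + i / N)) ≤ 8 * Real.pi * b * (1 / M * 1) := by gcongr
      _ ≤ a := by rwa [mul_one, mul_one_div, div_le_iff₀ hM0]

theorem IsQuasiPeriodic.one_le_mul_measure_variation (hq : IsQuasiPeriodic F)
    (hFm : StronglyMeasurable F) (ha : 0 < a) (hF : ∀ z, a ≤ ‖F z‖ ∧ ‖F z‖ ≤ b) {N M : ℕ}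
    (hN : 0 < N) (hM : 3 ≤ M) (hMb : 8 * Real.pi * b ≤ a * M) :
    1 ≤ (N * M : ℝ≥0∞) * (squareMeasure {z | a / 2 ≤ ‖F (z.1 + 1 / N, z.2) - F z‖}
      + squareMeasure
          {z | a / 2 ≤ ‖expi (-(1 / M * z.1)) * F (z.1, z.2 + 1 / M) - F z‖}) := by
  have hfst : MeasurableSet {z | a / 2 ≤ ‖F (z.1 + 1 / N, z.2) - F z‖} :=
    measurableSet_le measurable_const
      ((hFm.comp_measurable (by fun_prop)).sub hFm).norm.measurable
  have hsnd : MeasurableSet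
      {z | a / 2 ≤ ‖expi (-(1 / M * z.1)) * F (z.1, z.2 + 1 / M) - F z‖} :=
    measurableSet_le measurable_const
      (((Measurable.stronglyMeasurable (by fun_prop)).mul
        (hFm.comp_measurable (by fun_prop))).sub hFm).norm.measurable
  exact (one_le_mul_measure_of_grid hN (by omega) (hfst.union hsnd)
    fun x hx y _ => hq.exists_large_variation ha hF hN hM hMb hx y).trans
      (mul_le_mul_right (measure_union_le _ _) _)

theorem IsQuasiPeriodic.le_mul_timeFreqTail (hq : IsQuasiPeriodic F)
    (hFm : StronglyMeasurable F) (ha : 0 < a) (hF : ∀ z, a ≤ ‖F z‖ ∧ ‖F z‖ ≤ b)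
    (hg : MemLp (zakInv F) 2 volume) {c : ℤ → ℂ} {δ : ℝ} (hc : IsApproxDiffSeq c (a / (4 * b)) δ)
    {N M : ℕ} (hN : 0 < N) (hM : 3 ≤ M) (hMb : 8 * Real.pi * b ≤ a * M) {R L : ℝ}
    (hL : L ≤ δ * N) (hR : R ≤ δ * M) :
    a ^ 2 / 144 ≤ N * M * timeFreqTail (hg.toLp (zakInv F)) R L := by
  have hab : a ≤ b := (hF 0).1.trans (hF 0).2
  have hb : 0 < b := ha.trans_le hab
  have hεb : a / 4 + a / (4 * b) * b = a / 2 := by field_simp; norm_num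
  have hε : ENNReal.ofReal ((2 + a / (4 * b)) ^ 2) ≤ 9 := by
    have hε1 : a / (4 * b) ≤ 1 := by rw [div_le_one (by positivity)]; linarith
    have hε0 : 0 ≤ a / (4 * b) := by positivity
    exact ENNReal.ofReal_le_of_le_toReal (by norm_num; nlinarith)
  have hstep {n : ℕ} (hn : 0 < n) {r : ℝ} (hr : r ≤ δ * n) : |1 / (n : ℝ)| * r ≤ δ := by
    rwa [abs_of_nonneg (by positivity), one_div_mul_eq_div, div_le_iff₀ (by positivity)]
  have hfst := hq.measure_variation_fst_le hFm (fun z => (hF z).2) hg hc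
    (by positivity : 0 ≤ a / 4) (hstep hN hL)
  have hsnd := hq.measure_variation_snd_le hFm (fun z => (hF z).2) hc
    (by positivity : 0 ≤ a / 4) (hstep (by omega : 0 < M) hR)
  rw [hεb] at hfst hsnd
  have hmain : ENNReal.ofReal ((a / 4) ^ 2) ≤
      ENNReal.ofReal (N * M * (9 * timeFreqTail (hg.toLp (zakInv F)) R L)) := by
    calc ENNReal.ofReal ((a / 4) ^ 2) ≤ ENNReal.ofReal ((a / 4) ^ 2) * _ :=
          le_mul_of_one_le_right' (hq.one_le_mul_measure_variation hFm ha hF hN hM hMb)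
      _ ≤ N * M * (9 * (∫⁻ t in {t : ℝ | R ≤ |t|}, ‖zakInv F t‖ₑ ^ 2)
            + 9 * ∫⁻ ξ in {ξ : ℝ | L ≤ |ξ|}, ‖(𝓕 (hg.toLp (zakInv F)) : L2R) ξ‖ₑ ^ 2) := by
          rw [mul_left_comm, mul_add, add_comm]
          exact mul_le_mul_right (add_le_add (hsnd.trans (mul_le_mul_left hε _))
            (hfst.trans (mul_le_mul_left hε _))) _
      _ = ENNReal.ofReal (N * M * (9 * timeFreqTail (hg.toLp (zakInv F)) R L)) := by
          rw [← mul_add, ← ofReal_timeFreqTail_toLp, ENNReal.ofReal_mul (by positivity),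
            ENNReal.ofReal_mul (by positivity), ENNReal.ofReal_mul (by norm_num),
            ENNReal.ofReal_natCast, ENNReal.ofReal_natCast, ENNReal.ofReal_ofNat]
  rw [ENNReal.ofReal_le_ofReal_iff
    (mul_nonneg (by positivity) (mul_nonneg (by norm_num) (timeFreqTail_nonneg _ R L)))] at hmain
  linarith

theorem exists_nat_mul_le_and_le_add_one_mul {K r : ℝ} (hK : 0 ≤ K) (hr : 1 ≤ r) :
    ∃ n : ℕ, K * r ≤ n ∧ (n : ℝ) ≤ (K + 1) * r :=
  ⟨⌈K * r⌉₊, Nat.le_ceil _, by linarith [Nat.ceil_lt_add_one (a := K * r) (by positivity)]⟩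

theorem exists_timeFreqTail_lower_bound (ha : 0 < a) (hb : 0 < b) :
    ∃ C : ℝ, 0 < C ∧ ∀ F : ℝ × ℝ → ℂ,
      IsQuasiPeriodic F → StronglyMeasurable F → (∀ z, a ≤ ‖F z‖ ∧ ‖F z‖ ≤ b) →
      ∀ hg : MemLp (zakInv F) 2 volume, ∀ R L : ℝ, 1 ≤ R → 1 ≤ L →
        C / (R * L) ≤ timeFreqTail (hg.toLp (zakInv F)) R L := by
  obtain ⟨δ, hδ, c, hc⟩ := exists_isApproxDiffSeq (ε := a / (4 * b)) (by positivity)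
  obtain ⟨K, hδK, hbK, h3K⟩ : ∃ K : ℝ, 1 ≤ δ * K ∧ 8 * Real.pi * b ≤ a * K ∧ 3 ≤ K := by
    refine ⟨max (1 / δ) (max (8 * Real.pi * b / a) 3), ?_, ?_, ?_⟩
    · exact (div_le_iff₀' hδ).1 (le_max_left _ _)
    · exact (div_le_iff₀' ha).1 ((le_max_left _ _).trans (le_max_right _ _))
    · exact (le_max_right _ _).trans (le_max_right _ _)
  refine ⟨a ^ 2 / 144 / (K + 1) ^ 2, by positivity, fun F hq hFm hF hg R L hR hL => ?_⟩
  have hlarge {n : ℕ} {r : ℝ} (hr : 1 ≤ r) (hn : K * r ≤ n) : r ≤ δ * n ∧ K ≤ n := by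
    refine ⟨?_, (le_mul_of_one_le_right (by linarith) hr).trans hn⟩
    calc r ≤ δ * K * r := le_mul_of_one_le_left (by linarith) hδK
      _ = δ * (K * r) := mul_assoc _ _ _
      _ ≤ δ * n := mul_le_mul_of_nonneg_left hn hδ.le
  obtain ⟨N, hN, hN'⟩ := exists_nat_mul_le_and_le_add_one_mul (by linarith : 0 ≤ K) hL
  obtain ⟨M, hM, hM'⟩ := exists_nat_mul_le_and_le_add_one_mul (by linarith : 0 ≤ K) hR
  obtain ⟨hLN, hKN⟩ := hlarge hL hN
  obtain ⟨hRM, hKM⟩ := hlarge hR hM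
  have htail := timeFreqTail_nonneg (hg.toLp (zakInv F)) R L
  have hmain := hq.le_mul_timeFreqTail hFm ha hF hg hc
    (Nat.cast_pos.1 (by linarith : (0 : ℝ) < N)) (by exact_mod_cast h3K.trans hKM)
    (hbK.trans (mul_le_mul_of_nonneg_left hKM ha.le)) hLN hRM
  rw [div_div, div_le_iff₀' (by positivity)]
  calc a ^ 2 / 144 ≤ N * M * timeFreqTail (hg.toLp (zakInv F)) R L := hmain
    _ ≤ (K + 1) * L * ((K + 1) * R) * timeFreqTail (hg.toLp (zakInv F)) R L := by gcongr
    _ = (K + 1) ^ 2 * (R * L) * timeFreqTail (hg.toLp (zakInv F)) R L := by ring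

end LowerBound

theorem exists_isQuasiPeriodic_of_isRieszSequenceWithBounds {g : L2R} {A B : ℝ}
    (h : IsRieszSequenceWithBounds (gaborSystem g) A B) :
    ∃ F : ℝ × ℝ → ℂ, IsQuasiPeriodic F ∧ StronglyMeasurable F ∧
      (∀ z, √A ≤ ‖F z‖ ∧ ‖F z‖ ≤ √B) ∧ ∃ hg : MemLp (zakInv F) 2 volume, g = hg.toLp _ := by
  obtain ⟨f, rfl⟩ := zakInvEquiv.surjective g
  have hf := Lp.stronglyMeasurable f
  rw [← Lp.toLp_coeFn f (Lp.memLp f)] at h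
  have hbound : ∀ᵐ z ∂squareMeasure, √A ≤ ‖f z‖ ∧ ‖f z‖ ≤ √B := by
    filter_upwards [ae_bounds_of_isRieszSequenceWithBounds hf.measurable h] with z hz
    exact ⟨Real.sqrt_le_iff.2 ⟨norm_nonneg _, hz.1⟩, Real.le_sqrt_of_sq_le hz.2⟩
  obtain ⟨F, hq, hF, hFb, hfF⟩ := exists_isQuasiPeriodic_ae_eq hf (Real.sqrt_nonneg A) hbound
  have hg := memLp_zakInv hF ((memLp_congr_ae hfF).1 (Lp.memLp f))
  refine ⟨F, hq, hF, hFb, hg, Lp.ext ?_⟩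
  have hcoe := zakInvEquiv_toLp_coeFn (Lp.memLp f)
  rw [Lp.toLp_coeFn] at hcoe
  exact (hcoe.trans (zakInv_congr_ae hfF)).trans hg.coeFn_toLp.symm

theorem exists_lower_bound (A B : ℝ) : ∃ C : ℝ, 0 < C ∧
    ∀ g : L2R, IsRieszSequenceWithBounds (gaborSystem g) A B →
      ∀ R L : ℝ, 1 ≤ R → 1 ≤ L → C / (R * L) ≤ timeFreqTail g R L := by
  by_cases hAB : 0 < A ∧ 0 < B
  · obtain ⟨C, hC, hbound⟩ :=
      exists_timeFreqTail_lower_bound (Real.sqrt_pos.2 hAB.1) (Real.sqrt_pos.2 hAB.2)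
    refine ⟨C, hC, fun g hg R L hR hL => ?_⟩
    obtain ⟨F, hq, hF, hFb, hm, rfl⟩ := exists_isQuasiPeriodic_of_isRieszSequenceWithBounds hg
    exact hbound F hq hF hFb hm R L hR hL
  · exact ⟨1, one_pos, fun g hg => absurd ⟨hg.1, hg.2.1⟩ hAB⟩

/-! ### Tails and moduli of continuity -/

theorem norm_expi_sub_one_sq (t : ℝ) :
    ‖expi t - 1‖ ^ 2 = 2 - 2 * Real.cos (2 * Real.pi * t) := by
  rw [expi_eq, mul_comm, Complex.norm_exp_I_mul_ofReal_sub_one, Real.norm_eq_abs, sq_abs, mul_pow,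
    Real.sin_sq_eq_half_sub, mul_div_cancel₀ _ two_ne_zero]
  ring

theorem enorm_expi_neg_sub_one (t : ℝ) : ‖expi (-t) - 1‖ₑ = ‖expi t - 1‖ₑ := by
  have h : expi (-t) - 1 = -(expi (-t) * (expi t - 1)) := by
    rw [mul_sub, ← expi_add, neg_add_cancel, expi_zero, mul_one, neg_sub]
  rw [h, enorm_neg, enorm_mul, enorm_expi, one_mul]

theorem le_integral_norm_expi_sub_one_sq {R t : ℝ} (hR : 0 < R) (ht : R ≤ |t|) :
    1 / R ≤ ∫ s in (0 : ℝ)..(1 / R), ‖expi (s * t) - 1‖ ^ 2 := by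
  have htpos : 0 < |t| := hR.trans_le ht
  have hfreq : 2 * Real.pi * t ≠ 0 := mul_ne_zero (by positivity) (abs_pos.1 htpos)
  have hnorm (s : ℝ) : ‖expi (s * t) - 1‖ ^ 2 = 2 - 2 * Real.cos (2 * Real.pi * t * s) := by
    rw [norm_expi_sub_one_sq, mul_comm s, mul_assoc _ t]
  have hosc : |2 * ((2 * Real.pi * t)⁻¹ * Real.sin (2 * Real.pi * t * (1 / R)))| ≤ 1 / R := by
    rw [abs_mul, abs_mul, abs_inv, abs_mul, abs_of_pos Real.two_pi_pos, abs_two]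
    calc 2 * ((2 * Real.pi * |t|)⁻¹ * |Real.sin (2 * Real.pi * t * (1 / R))|)
        ≤ 2 * ((2 * Real.pi * |t|)⁻¹ * 1) := by
          gcongr
          exact Real.abs_sin_le_one _
      _ = 1 / (Real.pi * |t|) := by field_simp
      _ ≤ 1 / R := one_div_le_one_div_of_le hR
          (ht.trans (le_mul_of_one_le_left htpos.le (by linarith [Real.pi_gt_three])))
  calc 1 / R ≤ 1 / R * 2 - 2 * ((2 * Real.pi * t)⁻¹ * Real.sin (2 * Real.pi * t * (1 / R))) := by
        linarith [le_of_abs_le hosc]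
    _ = ∫ s in (0 : ℝ)..(1 / R), (2 - 2 * Real.cos (2 * Real.pi * t * s)) := by
        rw [intervalIntegral.integral_sub intervalIntegrable_const
          (Continuous.intervalIntegrable (by fun_prop) _ _), intervalIntegral.integral_const,
          intervalIntegral.integral_const_mul, intervalIntegral.integral_comp_mul_left _ hfreq,
          integral_cos, mul_zero, Real.sin_zero, sub_zero, sub_zero, smul_eq_mul, smul_eq_mul]
    _ = ∫ s in (0 : ℝ)..(1 / R), ‖expi (s * t) - 1‖ ^ 2 := by simp only [hnorm]

theorem le_lintegral_enorm_expi_sub_one_sq {R t : ℝ} (hR : 0 < R) (ht : R ≤ |t|) :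
    ENNReal.ofReal (1 / R) ≤ ∫⁻ s in Ioc 0 (1 / R), ‖expi (s * t) - 1‖ₑ ^ 2 := by
  have hcont : Continuous fun s => expi (s * t) - 1 := by fun_prop
  have hbound (s : ℝ) : ‖expi (s * t) - 1‖ ≤ 1 + 1 :=
    (norm_sub_le _ _).trans_eq (by rw [norm_expi, norm_one])
  rw [lintegral_enorm_sq_eq_ofReal
      (MemLp.of_bound hcont.aestronglyMeasurable _ (ae_of_all _ hbound)),
    ← intervalIntegral.integral_of_le (one_div_pos.2 hR).le]
  exact ENNReal.ofReal_le_ofReal (le_integral_norm_expi_sub_one_sq hR ht)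

-- `|expi (s * t) - 1|²` is bounded below for `R ≤ |t|` only on average over `s ∈ (0, 1 / R]`.
theorem setLIntegral_le_of_lintegral_enorm_expi_sub_one_sq_mul_le {k : ℝ → ℝ≥0∞}
    (hk : AEMeasurable k volume) {R : ℝ} (hR : 0 < R) {D : ℝ≥0∞}
    (hD : ∀ s, 0 < s → s ≤ 1 / R → ∫⁻ t, ‖expi (s * t) - 1‖ₑ ^ 2 * k t ≤ D) :
    ∫⁻ t in {t : ℝ | R ≤ |t|}, k t ≤ D := by
  have hmeas : AEMeasurable (Function.uncurry fun t s : ℝ => ‖expi (s * t) - 1‖ₑ ^ 2 * k t)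
      (volume.prod (volume.restrict (Ioc 0 (1 / R)))) := by
    have hexpi : Measurable fun p : ℝ × ℝ => ‖expi (p.2 * p.1) - 1‖ₑ ^ 2 := by fun_prop
    exact hexpi.aemeasurable.mul hk.comp_fst
  refine (ENNReal.mul_le_mul_iff_right (a := ENNReal.ofReal (1 / R)) (by simpa using hR)
    ENNReal.ofReal_ne_top).1 ?_
  calc ENNReal.ofReal (1 / R) * ∫⁻ t in {t : ℝ | R ≤ |t|}, k t
      = ∫⁻ t in {t : ℝ | R ≤ |t|}, ENNReal.ofReal (1 / R) * k t :=
        (lintegral_const_mul' _ _ ENNReal.ofReal_ne_top).symm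
    _ ≤ ∫⁻ t in {t : ℝ | R ≤ |t|}, ∫⁻ s in Ioc 0 (1 / R), ‖expi (s * t) - 1‖ₑ ^ 2 * k t := by
        refine setLIntegral_mono' (measurableSet_le_abs R) fun t ht => ?_
        rw [lintegral_mul_const _ (by fun_prop)]
        exact mul_le_mul_left (le_lintegral_enorm_expi_sub_one_sq hR ht) _
    _ ≤ ∫⁻ t, ∫⁻ s in Ioc 0 (1 / R), ‖expi (s * t) - 1‖ₑ ^ 2 * k t :=
        setLIntegral_le_lintegral _ _
    _ = ∫⁻ s in Ioc 0 (1 / R), ∫⁻ t, ‖expi (s * t) - 1‖ₑ ^ 2 * k t :=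
        lintegral_lintegral_swap hmeas
    _ ≤ ∫⁻ _ in Ioc 0 (1 / R), D :=
        setLIntegral_mono' measurableSet_Ioc fun s hs => hD s hs.1 hs.2
    _ = ENNReal.ofReal (1 / R) * D := by
        rw [setLIntegral_const, Real.volume_Ioc, sub_zero, mul_comm]

namespace IsQuasiPeriodic

variable {F : ℝ × ℝ → ℂ} {b : ℝ}

theorem lintegral_comp_add_fst_sub (hq : IsQuasiPeriodic F) (hF : StronglyMeasurable F)
    (hb : ∀ z, ‖F z‖ ≤ b) (hg : MemLp (zakInv F) 2 volume) (s : ℝ) :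
    ∫⁻ z, ‖F (z.1 + s, z.2) - F z‖ₑ ^ 2 ∂squareMeasure
      = ∫⁻ ξ, ‖expi (s * ξ) - 1‖ₑ ^ 2 * ‖(𝓕 (hg.toLp (zakInv F)) : L2R) ξ‖ₑ ^ 2 := by
  have h := lintegral_tsum_comp_add_fst hq hF hb hasSum_norm_diffSeq.summable hg fun j => j * s
  simpa only [(hasSum_diffSeq_mul _).tsum_eq, Int.cast_one, one_mul, Int.cast_zero, zero_mul,
    add_zero, expi_zero] using h

theorem lintegral_modulate_sub (hq : IsQuasiPeriodic F) (hF : StronglyMeasurable F)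
    (hb : ∀ z, ‖F z‖ ≤ b) (s : ℝ) :
    ∫⁻ z, ‖expi (-(s * z.1)) * F (z.1, z.2 + s) - F z‖ₑ ^ 2 ∂squareMeasure
      = ∫⁻ t, ‖expi (s * t) - 1‖ₑ ^ 2 * ‖zakInv F t‖ₑ ^ 2 := by
  have h := lintegral_tsum_modulate hq hF hb hasSum_norm_diffSeq.summable fun j => j * s
  simpa only [(hasSum_diffSeq_mul _).tsum_eq, Int.cast_one, one_mul, Int.cast_zero, zero_mul,
    add_zero, neg_zero, expi_zero, enorm_expi_neg_sub_one] using h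

theorem ofReal_timeFreqTail_le (hq : IsQuasiPeriodic F) (hF : StronglyMeasurable F)
    (hb : ∀ z, ‖F z‖ ≤ b) (hg : MemLp (zakInv F) 2 volume) {R L : ℝ} (hR : 0 < R) (hL : 0 < L)
    {D₁ D₂ : ℝ≥0∞}
    (h₁ : ∀ s, 0 < s → s ≤ 1 / L → ∫⁻ z, ‖F (z.1 + s, z.2) - F z‖ₑ ^ 2 ∂squareMeasure ≤ D₁)
    (h₂ : ∀ s, 0 < s → s ≤ 1 / R →
      ∫⁻ z, ‖expi (-(s * z.1)) * F (z.1, z.2 + s) - F z‖ₑ ^ 2 ∂squareMeasure ≤ D₂) :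
    ENNReal.ofReal (timeFreqTail (hg.toLp (zakInv F)) R L) ≤ D₂ + D₁ := by
  rw [ofReal_timeFreqTail_toLp]
  refine add_le_add ?_ ?_
  · refine setLIntegral_le_of_lintegral_enorm_expi_sub_one_sq_mul_le
      (hg.1.aemeasurable.enorm.pow_const 2) hR fun s hs hsR => ?_
    rw [← hq.lintegral_modulate_sub hF hb]
    exact h₂ s hs hsR
  · refine setLIntegral_le_of_lintegral_enorm_expi_sub_one_sq_mul_le
      ((Lp.aestronglyMeasurable _).aemeasurable.enorm.pow_const 2) hL fun s hs hsL => ?_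
    rw [← hq.lintegral_comp_add_fst_sub hF hb hg]
    exact h₁ s hs hsL

end IsQuasiPeriodic

section SingularIntegral

theorem integral_comp_abs_sub_half {φ : ℝ → ℝ} (hφ : ContinuousOn φ (Ici 0)) :
    ∫ y in (0 : ℝ)..1, φ |y - 1 / 2| = 2 * ∫ s in (0 : ℝ)..(1 / 2), φ s := by
  have hcont : Continuous fun y : ℝ => φ |y - 1 / 2| :=
    hφ.comp_continuous (by fun_prop) fun y => mem_Ici.2 (abs_nonneg _)
  have hleft : ∫ y in (0 : ℝ)..(1 / 2), φ |y - 1 / 2| = ∫ s in (0 : ℝ)..(1 / 2), φ s := by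
    rw [intervalIntegral.integral_congr (g := fun y => φ (1 / 2 - y)),
      intervalIntegral.integral_comp_sub_left φ, sub_self, sub_zero]
    intro y hy
    rw [uIcc_of_le one_half_pos.le] at hy
    simp only [abs_of_nonpos (sub_nonpos.2 hy.2), neg_sub]
  have hright : ∫ y in (1 / 2 : ℝ)..1, φ |y - 1 / 2| = ∫ s in (0 : ℝ)..(1 / 2), φ s := by
    rw [intervalIntegral.integral_congr (g := fun y => φ (y - 1 / 2)),
      intervalIntegral.integral_comp_sub_right φ, sub_self, sub_half]
    intro y hy
    rw [uIcc_of_le one_half_lt_one.le] at hy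
    simp only [abs_of_nonneg (sub_nonneg.2 hy.1)]
  rw [← intervalIntegral.integral_add_adjacent_intervals (b := 1 / 2)
    (hcont.intervalIntegrable _ _) (hcont.intervalIntegrable _ _), hleft, hright, two_mul]

theorem integral_inv_add_sq_le {α r : ℝ} (hα : 0 < α) (hr : 0 ≤ r) :
    ∫ s in (0 : ℝ)..r, ((α + s) ^ 2)⁻¹ ≤ α⁻¹ := by
  have hpos {s : ℝ} (hs : s ∈ uIcc 0 r) : 0 < α + s := by
    rw [uIcc_of_le hr] at hs
    linarith [hs.1]
  have hderiv (s : ℝ) (hs : s ∈ uIcc 0 r) :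
      HasDerivAt (fun s => -(α + s)⁻¹) ((α + s) ^ 2)⁻¹ s := by
    refine (((hasDerivAt_id s).const_add α).inv (hpos hs).ne').neg.congr_deriv ?_
    rw [neg_div, neg_neg, one_div, id]
  have hcont : ContinuousOn (fun s : ℝ => ((α + s) ^ 2)⁻¹) (uIcc 0 r) :=
    ContinuousOn.inv₀ (by fun_prop) fun s hs => (pow_pos (hpos hs) 2).ne'
  rw [intervalIntegral.integral_eq_sub_of_hasDerivAt hderiv hcont.intervalIntegrable, add_zero,
    sub_neg_eq_add, neg_add_le_iff_le_add]
  exact le_add_of_nonneg_left (inv_nonneg.2 (add_nonneg hα.le hr))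

theorem integral_inv_add {η r : ℝ} (hη : 0 < η) (hr : 0 ≤ r) :
    ∫ s in (0 : ℝ)..r, (η + s)⁻¹ = Real.log (1 + r / η) := by
  rw [intervalIntegral.integral_comp_add_left (fun s => s⁻¹), add_zero,
    integral_inv_of_pos hη (by linarith), add_div, div_self hη.ne']

theorem lintegral_unitMeasure_comp_abs_sub_half {φ : ℝ → ℝ} (hφ : ContinuousOn φ (Ici 0))
    (h0 : ∀ s, 0 ≤ s → 0 ≤ φ s) :
    ∫⁻ y, ENNReal.ofReal (φ |y - 1 / 2|) ∂unitMeasure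
      = ENNReal.ofReal (2 * ∫ s in (0 : ℝ)..(1 / 2), φ s) := by
  have hcont : Continuous fun y : ℝ => φ |y - 1 / 2| :=
    hφ.comp_continuous (by fun_prop) fun y => mem_Ici.2 (abs_nonneg _)
  rw [← integral_comp_abs_sub_half hφ, intervalIntegral.integral_of_le zero_le_one,
    unitMeasure_eq_Ioc, ofReal_integral_eq_lintegral_ofReal hcont.integrableOn_Ioc
      (ae_of_all _ fun y => h0 _ (abs_nonneg _))]

theorem lintegral_unitMeasure_inv_add_sq_le {α : ℝ} (hα : 0 < α) :
    ∫⁻ y, ENNReal.ofReal (((α + |y - 1 / 2|) ^ 2)⁻¹) ∂unitMeasure ≤ ENNReal.ofReal (2 * α⁻¹) := by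
  have hcont : ContinuousOn (fun s : ℝ => ((α + s) ^ 2)⁻¹) (Ici 0) :=
    ContinuousOn.inv₀ (by fun_prop) fun s (hs : 0 ≤ s) => by positivity
  rw [lintegral_unitMeasure_comp_abs_sub_half hcont fun s hs => by positivity]
  exact ENNReal.ofReal_le_ofReal
    (mul_le_mul_of_nonneg_left (integral_inv_add_sq_le hα one_half_pos.le) zero_le_two)

theorem lintegral_unitMeasure_inv_add {η : ℝ} (hη : 0 < η) :
    ∫⁻ x, ENNReal.ofReal (2 * (η + |x - 1 / 2|)⁻¹) ∂unitMeasure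
      = ENNReal.ofReal (4 * Real.log (1 + 1 / 2 / η)) := by
  have hcont : ContinuousOn (fun s : ℝ => 2 * (η + s)⁻¹) (Ici 0) :=
    continuousOn_const.mul
      (ContinuousOn.inv₀ (by fun_prop) fun s (hs : 0 ≤ s) => by positivity)
  rw [lintegral_unitMeasure_comp_abs_sub_half hcont fun s hs => by positivity,
    intervalIntegral.integral_const_mul, integral_inv_add hη one_half_pos.le, ← mul_assoc]
  norm_num

theorem lintegral_squareMeasure_inv_add_sq_le {η : ℝ} (hη : 0 < η) :
    ∫⁻ z, ENNReal.ofReal (((η + |z.1 - 1 / 2| + |z.2 - 1 / 2|) ^ 2)⁻¹) ∂squareMeasure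
      ≤ ENNReal.ofReal (4 * Real.log (1 + 1 / 2 / η)) := by
  have hcont : Continuous fun z : ℝ × ℝ => ((η + |z.1 - 1 / 2| + |z.2 - 1 / 2|) ^ 2)⁻¹ :=
    Continuous.inv₀ (by fun_prop) fun z => by positivity
  rw [lintegral_squareMeasure hcont.measurable.ennreal_ofReal.aemeasurable,
    ← lintegral_unitMeasure_inv_add hη]
  exact lintegral_mono fun x => lintegral_unitMeasure_inv_add_sq_le (by positivity)

end SingularIntegral

/-! ### The phase of the Zak transform of the hat function -/

theorem IsQuasiPeriodic.exists_norm_eq_one_mul_norm_eq {H : ℝ × ℝ → ℂ} (hq : IsQuasiPeriodic H)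
    (hH : StronglyMeasurable H) :
    ∃ F : ℝ × ℝ → ℂ, IsQuasiPeriodic F ∧ StronglyMeasurable F ∧ (∀ z, ‖F z‖ = 1) ∧
      ∀ z, F z * ‖H z‖ = H z := by
  have hmeas : Measurable fun z => Complex.exp (Complex.arg (H z) * Complex.I) := by
    have := hH.measurable
    fun_prop
  refine ⟨quasiExtend fun z => Complex.exp (Complex.arg (H z) * Complex.I),
    isQuasiPeriodic_quasiExtend _, stronglyMeasurable_quasiExtend hmeas.stronglyMeasurable,
    fun z => ?_, fun z => ?_⟩
  · rw [norm_quasiExtend, Complex.norm_exp_ofReal_mul_I]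
  · have hper : Function.Periodic (fun y => H (Int.fract z.1, y)) 1 := hq.add_one_snd _
    have hfract : H z = expi (⌊z.1⌋ * z.2) * H (Int.fract z.1, Int.fract z.2) := by
      rw [hq.eq_fract z.1 z.2]
      congr 1
      exact (hper.sub_zsmul_eq ⌊z.2⌋).symm.trans (by rw [zsmul_one, Int.self_sub_floor])
    rw [hfract, norm_mul, norm_expi, one_mul, quasiExtend, mul_assoc, mul_comm (Complex.exp _),
      Complex.norm_mul_exp_arg_mul_I]

/-- The Zak transform of the hat function `t ↦ max (1 - |t|) 0`, that is, the piecewise linear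
interpolation in `x` of the values `expi (n * y)` at the integers `x = n`. It vanishes on
`[0, 1)²` only at `(1/2, 1/2)`. -/
noncomputable def hatZak (z : ℝ × ℝ) : ℂ :=
  expi (⌊z.1⌋ * z.2) * (1 - Int.fract z.1 + Int.fract z.1 * expi z.2)

theorem isQuasiPeriodic_hatZak : IsQuasiPeriodic hatZak where
  add_one_fst x y := by
    simp only [hatZak, Int.floor_add_one, Int.fract_add_one, Int.cast_add, Int.cast_one, add_mul,
      one_mul, expi_add]
    ring
  add_one_snd x y := by
    have hexpi (n : ℤ) : expi (n * (y + 1)) = expi (n * y) := by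
      rw [mul_add, mul_one, expi_add_intCast]
    have hexpi_one : expi (y + 1) = expi y := by simpa only [Int.cast_one, one_mul] using hexpi 1
    simp only [hatZak, hexpi, hexpi_one]

theorem stronglyMeasurable_hatZak : StronglyMeasurable hatZak := by
  have hfloor : Measurable fun z : ℝ × ℝ => (⌊z.1⌋ : ℝ) :=
    measurable_from_top.comp (Int.measurable_floor.comp measurable_fst)
  exact Measurable.stronglyMeasurable (by unfold hatZak; fun_prop)

theorem hatZak_of_mem {x : ℝ} (hx : x ∈ Ico (0 : ℝ) 1) (y : ℝ) :
    hatZak (x, y) = 1 - x + x * expi y := by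
  rw [hatZak, Int.floor_eq_zero_iff.2 hx, Int.fract_eq_self.2 hx, Int.cast_zero, zero_mul,
    expi_zero, one_mul]

theorem norm_one_sub_add_mul_le_one {x : ℝ} (hx : x ∈ Icc (0 : ℝ) 1) {w : ℂ} (hw : ‖w‖ ≤ 1) :
    ‖1 - x + x * w‖ ≤ 1 := by
  have h := convex_closedBall (0 : ℂ) 1 (mem_closedBall_zero_iff.2 norm_one.le)
    (mem_closedBall_zero_iff.2 hw) (sub_nonneg.2 hx.2) hx.1 (sub_add_cancel _ _)
  simpa using h

theorem norm_one_sub_add_mul_sq (x : ℝ) {w : ℂ} (hw : ‖w‖ = 1) :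
    ‖1 - x + x * w‖ ^ 2 = 1 - x * (1 - x) * ‖w - 1‖ ^ 2 := by
  have hw2 : w.re * w.re + w.im * w.im = 1 := by
    rw [← Complex.normSq_apply, Complex.normSq_eq_norm_sq, hw, one_pow]
  simp only [← Complex.normSq_eq_norm_sq, Complex.normSq_apply, Complex.add_re, Complex.add_im,
    Complex.sub_re, Complex.sub_im, Complex.one_re, Complex.one_im, Complex.re_ofReal_mul,
    Complex.im_ofReal_mul, Complex.ofReal_re, Complex.ofReal_im]
  linear_combination x * hw2

theorem two_mul_abs_sub_half_le_abs_cos {y : ℝ} (hy : y ∈ Icc (0 : ℝ) 1) :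
    2 * |y - 1 / 2| ≤ |Real.cos (Real.pi * y)| := by
  have hhalf : |y - 1 / 2| ≤ 1 / 2 := abs_le.2 ⟨by linarith [hy.1], by linarith [hy.2]⟩
  have hcos : |Real.cos (Real.pi * y)| = |Real.sin (Real.pi * |y - 1 / 2|)| := by
    have hshift : Real.pi * y = Real.pi * (y - 1 / 2) + Real.pi / 2 := by ring
    rw [hshift, Real.cos_add_pi_div_two, abs_neg]
    rcases abs_choice (y - 1 / 2) with h | h <;> simp only [h, mul_neg, Real.sin_neg, abs_neg]
  calc 2 * |y - 1 / 2| = 2 / Real.pi * (Real.pi * |y - 1 / 2|) := by field_simp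
    _ ≤ Real.sin (Real.pi * |y - 1 / 2|) :=
        Real.mul_le_sin (by positivity) (by nlinarith [Real.pi_pos])
    _ ≤ |Real.cos (Real.pi * y)| := (le_abs_self _).trans_eq hcos.symm

theorem norm_expi_sub_one_sq_le {y : ℝ} (hy : y ∈ Icc (0 : ℝ) 1) :
    ‖expi y - 1‖ ^ 2 ≤ 4 * (1 - (2 * |y - 1 / 2|) ^ 2) := by
  have hsq := pow_le_pow_left₀ (by positivity) (two_mul_abs_sub_half_le_abs_cos hy) 2
  rw [sq_abs (Real.cos _)] at hsq
  rw [norm_expi_sub_one_sq, mul_assoc, Real.cos_two_mul]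
  linarith

theorem le_norm_hatZak {z : ℝ × ℝ} (h₁ : z.1 ∈ Ico (0 : ℝ) 1) (h₂ : z.2 ∈ Icc (0 : ℝ) 1) :
    |z.1 - 1 / 2| + |z.2 - 1 / 2| ≤ ‖hatZak z‖ := by
  obtain ⟨x, y⟩ := z
  have hx : x * (1 - x) = (1 - (2 * |x - 1 / 2|) ^ 2) / 4 := by
    rw [mul_pow, sq_abs]
    ring
  have hu : |x - 1 / 2| ≤ 1 / 2 := abs_le.2 ⟨by linarith [h₁.1], by linarith [h₁.2]⟩
  have hv : |y - 1 / 2| ≤ 1 / 2 := abs_le.2 ⟨by linarith [h₂.1], by linarith [h₂.2]⟩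
  have hy := norm_expi_sub_one_sq_le h₂
  refine le_of_sq_le_sq ?_ (norm_nonneg _)
  rw [hatZak_of_mem h₁, norm_one_sub_add_mul_sq x (norm_expi y), hx]
  have hu0 := abs_nonneg (x - 1 / 2)
  have hv0 := abs_nonneg (y - 1 / 2)
  generalize |x - 1 / 2| = u at *
  generalize |y - 1 / 2| = v at *
  have huv : u * v ≤ 1 / 4 := by nlinarith
  have hu1 : 0 ≤ (1 - (2 * u) ^ 2) / 4 := by nlinarith
  calc (u + v) ^ 2 ≤ 2 * (u ^ 2 + v ^ 2) := add_sq_le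
    _ ≤ 4 * (u ^ 2 + v ^ 2) - 16 * (u * v) ^ 2 := by
        nlinarith [sq_nonneg (u - v), mul_nonneg (mul_nonneg hu0 hv0) (sub_nonneg.2 huv)]
    _ = 1 - (1 - (2 * u) ^ 2) / 4 * (4 * (1 - (2 * v) ^ 2)) := by ring
    _ ≤ 1 - (1 - (2 * u) ^ 2) / 4 * ‖expi y - 1‖ ^ 2 := by gcongr

theorem norm_hatZak_add_fst_sub_le {x : ℝ} (hx : x ∈ Ico (0 : ℝ) 1) (y : ℝ) {s : ℝ} (hs : 0 ≤ s)
    (hs1 : s ≤ 1) : ‖hatZak (x + s, y) - hatZak (x, y)‖ ≤ s * ‖expi y - 1‖ := by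
  rw [hatZak_of_mem hx]
  rcases lt_or_ge (x + s) 1 with hxs | hxs
  · have hdiff : 1 - ((x + s : ℝ) : ℂ) + (x + s : ℝ) * expi y - (1 - x + x * expi y)
        = s * (expi y - 1) := by
      push_cast
      ring
    rw [hatZak_of_mem ⟨by linarith [hx.1], hxs⟩, hdiff, norm_mul, Complex.norm_of_nonneg hs]
  · have hdiff : expi y * (1 - ((x + s - 1 : ℝ) : ℂ) + (x + s - 1 : ℝ) * expi y)
        - (1 - x + x * expi y)
        = (((1 - x : ℝ) : ℂ) + (x + s - 1 : ℝ) * expi y) * (expi y - 1) := by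
      push_cast
      ring
    have hcoef : ‖((1 - x : ℝ) : ℂ) + (x + s - 1 : ℝ) * expi y‖ ≤ s := by
      refine (norm_add_le _ _).trans_eq ?_
      rw [norm_mul, norm_expi, Complex.norm_of_nonneg (by linarith [hx.2]),
        Complex.norm_of_nonneg (by linarith)]
      ring
    rw [← sub_add_cancel (x + s) 1, isQuasiPeriodic_hatZak.add_one_fst,
      hatZak_of_mem ⟨by linarith, by linarith [hx.2]⟩, hdiff, norm_mul]
    gcongr

theorem norm_modulate_hatZak_sub_le {x : ℝ} (hx : x ∈ Ico (0 : ℝ) 1) (y : ℝ) {s : ℝ}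
    (hs : 0 ≤ s) :
    ‖expi (-(s * x)) * hatZak (x, y + s) - hatZak (x, y)‖ ≤ 4 * Real.pi * s := by
  have hdiff : expi (-(s * x)) * (1 - x + x * expi (y + s)) - (1 - x + x * expi y)
      = (expi (-(s * x)) - 1) * (1 - x + x * expi (y + s)) + x * (expi y * (expi s - 1)) := by
    rw [expi_add]
    ring
  have hmod : ‖(expi (-(s * x)) - 1) * (1 - x + x * expi (y + s))‖ ≤ 2 * Real.pi * s := by
    rw [norm_mul]
    refine (mul_le_of_le_one_right (norm_nonneg _)
      (norm_one_sub_add_mul_le_one ⟨hx.1, hx.2.le⟩ (norm_expi _).le)).trans ?_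
    refine (norm_expi_sub_one_le _).trans ?_
    rw [abs_neg, abs_of_nonneg (mul_nonneg hs hx.1)]
    gcongr
    exact mul_le_of_le_one_right hs hx.2.le
  have htrans : ‖x * (expi y * (expi s - 1))‖ ≤ 2 * Real.pi * s := by
    rw [norm_mul, norm_mul, norm_expi, one_mul, Complex.norm_of_nonneg hx.1]
    refine (mul_le_of_le_one_left (norm_nonneg _) hx.2.le).trans ?_
    exact (norm_expi_sub_one_le s).trans_eq (by rw [abs_of_nonneg hs])
  rw [hatZak_of_mem hx, hatZak_of_mem hx, hdiff]
  linarith [norm_add_le ((expi (-(s * x)) - 1) * (1 - x + x * expi (y + s)))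
    (x * (expi y * (expi s - 1)))]

theorem norm_sub_mul_norm_le {u u' w w' : ℂ} (h : u * ‖w‖ = w) (h' : u' * ‖w'‖ = w')
    (hu' : ‖u'‖ = 1) : ‖u' - u‖ * ‖w‖ ≤ 2 * ‖w' - w‖ := by
  have hsplit : (u' - u) * (‖w‖ : ℂ) = u' * ((‖w‖ - ‖w'‖ : ℝ) : ℂ) + (w' - w) := by
    push_cast
    linear_combination h' - h
  calc ‖u' - u‖ * ‖w‖ = ‖(u' - u) * (‖w‖ : ℂ)‖ := by rw [norm_mul, Complex.norm_real, norm_norm]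
    _ ≤ ‖u' * ((‖w‖ - ‖w'‖ : ℝ) : ℂ)‖ + ‖w' - w‖ := hsplit ▸ norm_add_le _ _
    _ = |‖w'‖ - ‖w‖| + ‖w' - w‖ := by
        rw [norm_mul, hu', one_mul, Complex.norm_real, Real.norm_eq_abs, abs_sub_comm]
    _ ≤ 2 * ‖w' - w‖ := by linarith [abs_norm_sub_norm_le w' w]

section Phase

variable {F P G : ℝ × ℝ → ℂ} {η : ℝ}

theorem norm_sub_mul_le_of_mul_norm_eq (hη : 0 ≤ η) (hF : ∀ z, ‖F z‖ = 1)
    (hFH : ∀ z, F z * ‖hatZak z‖ = hatZak z) (hP : ∀ z, ‖P z‖ = 1) (hPG : ∀ z, P z * ‖G z‖ = G z)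
    {z : ℝ × ℝ} (h₁ : z.1 ∈ Ico (0 : ℝ) 1) (h₂ : z.2 ∈ Icc (0 : ℝ) 1)
    (hG : ‖G z - hatZak z‖ ≤ 13 * η) :
    ‖P z - F z‖ * (η + |z.1 - 1 / 2| + |z.2 - 1 / 2|) ≤ 28 * η := by
  have htwo : ‖P z - F z‖ ≤ 2 := (norm_sub_le _ _).trans (by rw [hP, hF]; norm_num)
  calc ‖P z - F z‖ * (η + |z.1 - 1 / 2| + |z.2 - 1 / 2|)
      ≤ ‖P z - F z‖ * (η + ‖hatZak z‖) := by
        rw [add_assoc]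
        gcongr
        exact le_norm_hatZak h₁ h₂
    _ = ‖P z - F z‖ * η + ‖P z - F z‖ * ‖hatZak z‖ := mul_add _ _ _
    _ ≤ 2 * η + 2 * (13 * η) := add_le_add (mul_le_mul_of_nonneg_right htwo hη)
        ((norm_sub_mul_norm_le (hFH z) (hPG z) (hP z)).trans
          (mul_le_mul_of_nonneg_left hG zero_le_two))
    _ = 28 * η := by ring

theorem lintegral_enorm_sub_sq_le_of_mul_norm_eq (hη : 0 < η) (hF : ∀ z, ‖F z‖ = 1)
    (hFH : ∀ z, F z * ‖hatZak z‖ = hatZak z) (hP : ∀ z, ‖P z‖ = 1) (hPG : ∀ z, P z * ‖G z‖ = G z)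
    (hG : ∀ z : ℝ × ℝ, z.1 ∈ Ico (0 : ℝ) 1 → ‖G z - hatZak z‖ ≤ 13 * η) :
    ∫⁻ z, ‖P z - F z‖ₑ ^ 2 ∂squareMeasure
      ≤ ENNReal.ofReal (3136 * η ^ 2 * Real.log (1 + 1 / 2 / η)) := by
  have hpointwise : ∀ᵐ z ∂squareMeasure, ‖P z - F z‖ₑ ^ 2 ≤ ENNReal.ofReal ((28 * η) ^ 2) *
      ENNReal.ofReal (((η + |z.1 - 1 / 2| + |z.2 - 1 / 2|) ^ 2)⁻¹) := by
    filter_upwards [ae_squareMeasure_mem] with z hz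
    rw [← ofReal_norm, ← ENNReal.ofReal_pow (norm_nonneg _), ← ENNReal.ofReal_mul (by positivity)]
    refine ENNReal.ofReal_le_ofReal ?_
    rw [← div_eq_mul_inv, le_div_iff₀ (by positivity), ← mul_pow]
    exact pow_le_pow_left₀ (by positivity) (norm_sub_mul_le_of_mul_norm_eq hη.le hF hFH hP hPG
      hz.1 (Ico_subset_Icc_self hz.2) (hG z hz.1)) 2
  calc ∫⁻ z, ‖P z - F z‖ₑ ^ 2 ∂squareMeasure
      ≤ ∫⁻ z, ENNReal.ofReal ((28 * η) ^ 2) *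
          ENNReal.ofReal (((η + |z.1 - 1 / 2| + |z.2 - 1 / 2|) ^ 2)⁻¹) ∂squareMeasure :=
        lintegral_mono_ae hpointwise
    _ ≤ ENNReal.ofReal ((28 * η) ^ 2) * ENNReal.ofReal (4 * Real.log (1 + 1 / 2 / η)) := by
        rw [lintegral_const_mul' _ _ ENNReal.ofReal_ne_top]
        exact mul_le_mul_right (lintegral_squareMeasure_inv_add_sq_le hη) _
    _ = ENNReal.ofReal (3136 * η ^ 2 * Real.log (1 + 1 / 2 / η)) := by
        rw [← ENNReal.ofReal_mul (by positivity)]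
        ring_nf

theorem lintegral_comp_add_fst_sub_le_log (hF : ∀ z, ‖F z‖ = 1)
    (hFH : ∀ z, F z * ‖hatZak z‖ = hatZak z) (hη : 0 < η) (hη1 : η ≤ 1) {s : ℝ} (hs : 0 < s)
    (hsη : s ≤ η) :
    ∫⁻ z, ‖F (z.1 + s, z.2) - F z‖ₑ ^ 2 ∂squareMeasure
      ≤ ENNReal.ofReal (3136 * η ^ 2 * Real.log (1 + 1 / 2 / η)) := by
  refine lintegral_enorm_sub_sq_le_of_mul_norm_eq (P := fun z => F (z.1 + s, z.2))
    (G := fun z => hatZak (z.1 + s, z.2)) hη hF hFH (fun z => hF _) (fun z => hFH _) fun z hz => ?_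
  have hexpi : ‖expi z.2 - 1‖ ≤ 2 :=
    (norm_sub_le _ _).trans (by rw [norm_expi, norm_one]; norm_num)
  calc ‖hatZak (z.1 + s, z.2) - hatZak z‖ ≤ s * ‖expi z.2 - 1‖ :=
        norm_hatZak_add_fst_sub_le hz z.2 hs.le (hsη.trans hη1)
    _ ≤ η * 2 := by gcongr
    _ ≤ 13 * η := by linarith

theorem lintegral_modulate_sub_le_log (hF : ∀ z, ‖F z‖ = 1)
    (hFH : ∀ z, F z * ‖hatZak z‖ = hatZak z) (hη : 0 < η) {s : ℝ} (hs : 0 < s) (hsη : s ≤ η) :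
    ∫⁻ z, ‖expi (-(s * z.1)) * F (z.1, z.2 + s) - F z‖ₑ ^ 2 ∂squareMeasure
      ≤ ENNReal.ofReal (3136 * η ^ 2 * Real.log (1 + 1 / 2 / η)) := by
  refine lintegral_enorm_sub_sq_le_of_mul_norm_eq
    (P := fun z => expi (-(s * z.1)) * F (z.1, z.2 + s))
    (G := fun z => expi (-(s * z.1)) * hatZak (z.1, z.2 + s)) hη hF hFH
    (fun z => by rw [norm_mul, norm_expi, one_mul, hF])
    (fun z => by rw [norm_mul, norm_expi, one_mul, mul_assoc, hFH]) fun z hz => ?_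
  calc ‖expi (-(s * z.1)) * hatZak (z.1, z.2 + s) - hatZak z‖ ≤ 4 * Real.pi * s :=
        norm_modulate_hatZak_sub_le hz z.2 hs.le
    _ ≤ 4 * 3.15 * η := by
        gcongr
        exact Real.pi_lt_d2.le
    _ ≤ 13 * η := by linarith

theorem timeFreqTail_le_log (hq : IsQuasiPeriodic F) (hFm : StronglyMeasurable F)
    (hF : ∀ z, ‖F z‖ = 1) (hFH : ∀ z, F z * ‖hatZak z‖ = hatZak z)
    (hg : MemLp (zakInv F) 2 volume) {R : ℝ} (hR : 2 ≤ R) :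
    timeFreqTail (hg.toLp (zakInv F)) R R ≤ 6272 * Real.log (R * R) / (R * R) := by
  have hR0 : 0 < R := by linarith
  have hη : 0 < 1 / R := one_div_pos.2 hR0
  have hη1 : 1 / R ≤ 1 := (div_le_one hR0).2 (by linarith)
  have hlog : Real.log (1 + 1 / 2 / (1 / R)) ≤ Real.log (R * R) := by
    refine Real.log_le_log (by positivity) ?_
    rw [div_div_eq_mul_div, div_one]
    nlinarith
  have hlog0 : 0 ≤ Real.log (1 + 1 / 2 / (1 / R)) :=
    Real.log_nonneg (le_add_of_nonneg_right (by positivity))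
  have htail := hq.ofReal_timeFreqTail_le hFm (fun z => (hF z).le) hg hR0 hR0
    (fun s => lintegral_comp_add_fst_sub_le_log hF hFH hη hη1)
    (fun s => lintegral_modulate_sub_le_log hF hFH hη)
  rw [← ENNReal.ofReal_add (by positivity) (by positivity),
    ENNReal.ofReal_le_ofReal_iff (by positivity)] at htail
  calc timeFreqTail (hg.toLp (zakInv F)) R R
      ≤ 3136 * (1 / R) ^ 2 * Real.log (1 + 1 / 2 / (1 / R))
        + 3136 * (1 / R) ^ 2 * Real.log (1 + 1 / 2 / (1 / R)) := htail
    _ ≤ 3136 * (1 / R) ^ 2 * Real.log (R * R) + 3136 * (1 / R) ^ 2 * Real.log (R * R) := by gcongr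
    _ = 6272 * Real.log (R * R) / (R * R) := by
        field_simp
        ring

end Phase

theorem exists_isOrthonormalBasis_timeFreqTail_lt_log :
    ∃ g : L2R, IsOrthonormalBasis (gaborSystem g) ∧
      ∃ C₀ : ℝ, 0 < C₀ ∧ ∀ C : ℝ, C₀ ≤ C →
        ∀ R : ℝ, 2 ≤ R → timeFreqTail g R R < C * Real.log (R * R) / (R * R) := by
  obtain ⟨F, hq, hFm, hF, hFH⟩ :=
    isQuasiPeriodic_hatZak.exists_norm_eq_one_mul_norm_eq stronglyMeasurable_hatZak
  have hF2 : MemLp F 2 squareMeasure :=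
    MemLp.of_bound hFm.aestronglyMeasurable 1 (ae_of_all _ fun z => (hF z).le)
  have hg : MemLp (zakInv F) 2 volume := memLp_zakInv hFm hF2
  have hzak : zakInvEquiv (hF2.toLp F) = hg.toLp (zakInv F) :=
    Lp.ext ((zakInvEquiv_toLp_coeFn hF2).trans hg.coeFn_toLp.symm)
  refine ⟨hg.toLp (zakInv F), hzak ▸ isOrthonormalBasis_gaborSystem hF2 hF, 6273, by norm_num,
    fun C hC R hR => (timeFreqTail_le_log hq hFm hF hFH hg hR).trans_lt ?_⟩
  have hlog : 0 < Real.log (R * R) := Real.log_pos (by nlinarith)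
  gcongr
  linarith

theorem theorem1_general :
    (∀ A B : ℝ, ∃ C : ℝ, 0 < C ∧
      ∀ g : L2R, IsRieszSequenceWithBounds (gaborSystem g) A B →
        ∀ R L : ℝ, 1 ≤ R → 1 ≤ L → C / (R * L) ≤ timeFreqTail g R L) ∧
    (∃ g : L2R, IsOrthonormalBasis (gaborSystem g) ∧
      ∃ C₀ : ℝ, 0 < C₀ ∧ ∀ C : ℝ, C₀ ≤ C →
        ∀ R : ℝ, 2 ≤ R → timeFreqTail g R R < C * Real.log (R * R) / (R * R)) :=
  ⟨exists_lower_bound, exists_isOrthonormalBasis_timeFreqTail_lt_log⟩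

theorem theorem1 :
    (∀ A B : ℝ, ∃ C : ℝ, 0 < C ∧
      ∀ g : L2R, IsRieszBasisWithBounds (gaborSystem g) A B →
        ∀ R L : ℝ, 1 ≤ R → 1 ≤ L → C / (R * L) ≤ timeFreqTail g R L) ∧
    (∃ g : L2R, IsOrthonormalBasis (gaborSystem g) ∧
      ∃ C₀ : ℝ, 0 < C₀ ∧ ∀ C : ℝ, C₀ ≤ C →
        ∀ R : ℝ, 2 ≤ R → timeFreqTail g R R < C * Real.log (R * R) / (R * R)) :=
  theorem1_general.imp_left fun h A B =>
    (h A B).imp fun _ hC => hC.imp_right fun hg g hgAB => hg g hgAB.isRieszSequenceWithBounds
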